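/- Let $S$ be a finite commutative semigroup. Its semigroup determinant is the polynomial $\theta_S=\det\,[x_{st}]_{s,t\in S}\in\mathbb C[x_s\mid s\in S]$, where the $x_s$, $s\in S$, are variables. If $S^2\neq S$, then $\theta_S=0$. Suppose that $S^2=S$. Let $E(S)$ be the set of idempotents of $S$, ordered by $e\le f$ iff $ef=e$. For $s\in S$ let $s^+$ be the least $e\in E(S)$ with $se=s$. The relation $s\le t$ iff $s\in tE(S)$ is a partial order on $S$; let $\mu_S$ be its Möbius function. For $e\in E(S)$ let $G_e$ be the group of units of the monoid $eSe$, let $\widehat{G_e}$ be the group of characters $\chi\colon G_e\to\mathbb C^\times$, and let $\widetilde H_e=\{s\in S\mid s^+=e\}\subseteq eSe$. Let $\widetilde H_e^0=\widetilde H_e\cup\{z\}$ be the monoid with zero $z$ in which the product of $a,b\in\widetilde H_e$ is $ab$ if $ab\in\widetilde H_e$, and $z$ otherwise. (It is the Rees quotient of $eSe$ by the ideal $I_e=\{s\mid s^+<e\}$ if $I_e\ne\emptyset$, and $eSe=G_e$ with an adjoined zero if $I_e=\emptyset$.) For $\chi\in\widehat{G_e}$ let $I_\chi$ be the set of $m\in\widetilde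 H_e^0$ whose stabilizer in $G_e$ is not contained in $\ker\chi$; it is empty or an ideal. Let $\widetilde H_e^0/I_\chi$ be the Rees quotient (which is $\widetilde H_e^0$ if $I_\chi=\emptyset$), and let $(\widetilde H_e^0/I_\chi)/G_e$ be the monoid of its $G_e$-orbits. An element $m$ of the latter monoid is called annihilating if $m$ is nonzero and $mn$ is zero for every $n$ different from the identity. Fix, for each $e\in E(S)$, a set $T_e$ of representatives of the orbits of $G_e$ on $\widetilde H_e$ with $e\in T_e$, and let $T_{e,\chi}$ be the set of those $s\in T_e$ whose stabilizer in $G_e$ is contained in $\ker\chi$. If $\theta_S\ne0$, then for each $e\in E(S)$ and each $\chi\in\widehat{G_e}$ the monoid $(\widetilde H_e^0/I_\chi)/G_e$ has a unique annihilating element. Whenever all of these monoids have a unique annihilating element, the formula below holds. Let $s_\chi\in T_{e,\chi}$ be the representative of the orbit that is the annihilating element of $(\widetilde H_e^0/I_\chi)/G_e$, and let $A(\chi)$ be the $T_{e,\chi}\times T_{e,\chi}$ matrix with $A(\chi)_{s,t}=\chi(g)$ if $st=gs_\chi$ with $g\in G_e$, and $A(\chi)_{s,t}=0$ if there is no such $g$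 (this does not depend on the choice of $g$). Then \[ \theta_S=\pm\prod_{e\in E(S)}\ \prod_{\chi\in\widehat{G_e}}\left(\prod_{s\in T_{e,\chi}}\frac{|G_es|}{|G_e|}\right)\det A(\chi)\cdot\left(\sum_{g\in G_e}\overline{\chi(g)}\sum_{t\le gs_\chi}\mu_S(t,gs_\chi)\,x_t\right)^{|T_{e,\chi}|}. \] -/

import Mathlib

open scoped Pointwise

noncomputable section

namespace SemigroupDet

universe u

/-! ### The semigroup determinant -/

/-- The Cayley table of `S`: the `S × S` matrix with `(s, t)` entry the variable `x_{st}`. -/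
def cayleyTable (S : Type u) [Mul S] : Matrix S S (MvPolynomial S ℂ) :=
  Matrix.of fun s t => MvPolynomial.X (s * t)

/-- The (Dedekind-Frobenius) semigroup determinant `θ_S`, a polynomial in variables `x_s`,
`s ∈ S`, over `ℂ`. -/
def theta (S : Type u) [Mul S] [Fintype S] [DecidableEq S] : MvPolynomial S ℂ :=
  (cayleyTable S).det

/-- The condition `S² = S`. -/
def SquareEqSelf (S : Type u) [Mul S] : Prop :=
  (Set.univ : Set S) * (Set.univ : Set S) = Set.univ

/-! ### Rees quotients and quotients by a group of units -/

section Quotients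

/-- The Rees congruence of an ideal `I` of a commutative monoid: `I` is collapsed to a point.
If `I = ∅` this is the equality relation. -/
def reesCon {M : Type u} [CommMonoid M] (I : SemigroupIdeal M) : Con M where
  r a b := a = b ∨ (a ∈ I ∧ b ∈ I)
  iseqv :=
    { refl := fun _ => Or.inl rfl
      symm := by
        rintro a b (h | ⟨h1, h2⟩)
        · exact Or.inl h.symm
        · exact Or.inr ⟨h2, h1⟩
      trans := by
        rintro a b c (rfl | ⟨h1, h2⟩) (rfl | ⟨h3, h4⟩)
        · exact Or.inl rfl
        · exact Or.inr ⟨h3, h4⟩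
        · exact Or.inr ⟨h1, h2⟩
        · exact Or.inr ⟨h1, h4⟩ }
  mul' := by
    rintro a b c d (rfl | ⟨h1, h2⟩) (rfl | ⟨h3, h4⟩)
    · exact Or.inl rfl
    · exact Or.inr ⟨I.mul_mem _ h3, I.mul_mem _ h4⟩
    · rw [mul_comm a c, mul_comm b c]
      exact Or.inr ⟨I.mul_mem _ h1, I.mul_mem _ h2⟩
    · exact Or.inr ⟨I.mul_mem _ h3, I.mul_mem _ h4⟩

/-- The congruence on a commutative monoid `M` whose classes are the orbits `Gm` of a group `G`
acting on `M` by multiplication through a homomorphism `φ : G → M`. -/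
def orbitCon {G : Type u} {M : Type u} [Group G] [CommMonoid M] (φ : G →* M) : Con M where
  r a b := ∃ g : G, b = φ g * a
  iseqv :=
    { refl := fun a => ⟨1, by simp⟩
      symm := by
        rintro a b ⟨g, rfl⟩
        exact ⟨g⁻¹, by rw [← mul_assoc, ← map_mul]; simp⟩
      trans := by
        rintro a b c ⟨g, rfl⟩ ⟨h, rfl⟩
        exact ⟨h * g, by rw [map_mul, mul_assoc]⟩ }
  mul' := by
    rintro a b c d ⟨g, rfl⟩ ⟨h, rfl⟩
    exact ⟨g * h, by rw [map_mul, mul_mul_mul_comm]⟩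

/-- A quotient of a commutative monoid with zero is a commutative monoid with zero. -/
@[reducible]
def conCommMonoidWithZero {M : Type u} [CommMonoidWithZero M] (c : Con M) :
    CommMonoidWithZero c.Quotient :=
  { (inferInstance : CommMonoid c.Quotient) with
    zero := c.toQuotient 0
    zero_mul := by
      intro a
      induction a using Con.induction_on with
      | H a => exact congrArg c.toQuotient (zero_mul a)
    mul_zero := by
      intro a
      induction a using Con.induction_on with
      | H a => exact congrArg c.toQuotient (mul_zero a) }

/-- The Rees quotient `M / I`, for an ideal `I` of a commutative monoid with zero `M`, with the
convention `M / ∅ = M`. -/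
def ReesQuotient {M : Type u} [CommMonoidWithZero M] (I : SemigroupIdeal M) : Type u :=
  (reesCon I).Quotient

instance {M : Type u} [CommMonoidWithZero M] (I : SemigroupIdeal M) :
    CommMonoidWithZero (ReesQuotient I) :=
  conCommMonoidWithZero (reesCon I)

/-- The projection `M → M / I`. -/
def ReesQuotient.mk {M : Type u} [CommMonoidWithZero M] (I : SemigroupIdeal M) :
    M →* ReesQuotient I :=
  (reesCon I).mk'

/-- The monoid `M / G = {Gm ∣ m ∈ M}` of orbits of `G` on `M`. -/
def OrbitMonoid {G : Type u} {M : Type u} [Group G] [CommMonoidWithZero M] (φ : G →* M) :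
    Type u :=
  (orbitCon φ).Quotient

instance {G : Type u} {M : Type u} [Group G] [CommMonoidWithZero M] (φ : G →* M) :
    CommMonoidWithZero (OrbitMonoid φ) :=
  conCommMonoidWithZero (orbitCon φ)

/-- The projection `M → M / G`, `m ↦ Gm`. -/
def OrbitMonoid.mk {G : Type u} {M : Type u} [Group G] [CommMonoidWithZero M] (φ : G →* M) :
    M →* OrbitMonoid φ :=
  (orbitCon φ).mk'

/-- An annihilating element of a commutative monoid `M = N ∪ {1}`, where `N = M \ {1}` is a
nilpotent semigroup with zero: a nonzero `m` with `mN = {0}`. -/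
def IsAnnihilating {M : Type u} [CommMonoidWithZero M] (m : M) : Prop :=
  m ≠ 0 ∧ ∀ n : M, n ≠ 1 → m * n = 0

end Quotients

/-! ### Idempotents, the operation `s ↦ s⁺` and the natural partial order -/

/-- The set `E(S)` of idempotents. It carries Mathlib's order: `e ≤ f` iff `e * f = e`. -/
abbrev Idem (S : Type u) [Mul S] : Type u := {e : S // IsIdempotentElem e}

instance (S : Type u) [Mul S] [Finite S] : Fintype (Idem S) := Fintype.ofFinite _

/-- `IsPlus s e` says that `e = s⁺`: `e` is the least idempotent with `s * e = s`. -/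
def IsPlus {S : Type u} [CommSemigroup S] (s : S) (e : Idem S) : Prop :=
  IsLeast {f : Idem S | s * (f : S) = s} e

/-- In a finite commutative semigroup, `s⁺` exists as soon as some idempotent fixes `s`. -/
theorem exists_isPlus {S : Type u} [CommSemigroup S] [Finite S] (s : S) (e : Idem S)
    (he : s * (e : S) = s) : ∃ f : Idem S, IsPlus s f := by
  obtain ⟨f, hf, hmin⟩ := (Set.toFinite {f : Idem S | s * (f : S) = s}).exists_minimal ⟨e, he⟩
  refine ⟨f, hf, fun f' hf' => ?_⟩
  have hmem : (f ⊓ f' : Idem S) ∈ {f : Idem S | s * (f : S) = s} := by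
    change s * ((f : S) * (f' : S)) = s
    rw [← mul_assoc, show s * (f : S) = s from hf, show s * (f' : S) = s from hf']
  exact le_trans (hmin hmem inf_le_left) inf_le_right

/-- The relation `s ≤ t` iff `s ∈ t E(S)`. -/
def NatLE {S : Type u} [CommSemigroup S] (s t : S) : Prop :=
  ∃ e : Idem S, s = t * (e : S)

/-- If `S` is finite and commutative and `S² = S`, then each element is fixed by an idempotent. -/
theorem exists_idem_mul {S : Type u} [CommSemigroup S] [Finite S] (h : SquareEqSelf S) (s : S) :
    ∃ e : Idem S, s * (e : S) = s := by
  have hfac : ∀ s : S, ∃ a b : S, s = a * b := by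
    intro s
    have : s ∈ (Set.univ : Set S) * (Set.univ : Set S) := by rw [h]; trivial
    obtain ⟨a, -, b, -, hab⟩ := this
    exact ⟨a, b, hab.symm⟩
  choose f g hfg using hfac
  have step : ∀ (n : ℕ) (t : S), ∃ w : S, t = f^[n + 1] t * w := by
    intro n
    induction n with
    | zero => intro t; exact ⟨g t, hfg t⟩
    | succ n ih =>
      intro t
      obtain ⟨w, hw⟩ := ih (f t)
      refine ⟨w * g t, ?_⟩
      rw [Function.iterate_succ_apply, ← mul_assoc, ← hw]
      exact hfg t
  have key : ∃ u : S, s * u = s := by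
    obtain ⟨i, j, hij, hEq⟩ := Finite.exists_ne_map_eq_of_infinite fun n : ℕ => f^[n + 1] s
    have main : ∀ i j : ℕ, i < j → f^[i + 1] s = f^[j + 1] s → ∃ u : S, s * u = s := by
      intro i j hlt hEq
      obtain ⟨d, rfl⟩ := Nat.exists_eq_add_of_lt hlt
      obtain ⟨u, hu⟩ := step d (f^[i + 1] s)
      obtain ⟨w, hw⟩ := step i s
      rw [← Function.iterate_add_apply, show d + 1 + (i + 1) = i + d + 1 + 1 by omega,
        ← hEq] at hu
      refine ⟨u, ?_⟩
      calc s * u = f^[i + 1] s * w * u := by rw [← hw]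
        _ = f^[i + 1] s * u * w := by rw [mul_right_comm]
        _ = s := by rw [← hu, ← hw]
    rcases lt_or_gt_of_ne hij with hlt | hlt
    · exact main i j hlt hEq
    · exact main j i hlt hEq.symm
  obtain ⟨u, hu⟩ := key
  let _ : TopologicalSpace S := ⊥
  have _ : DiscreteTopology S := ⟨rfl⟩
  obtain ⟨e, he, hee⟩ := exists_idempotent_in_compact_subsemigroup
    (fun _ => continuous_of_discreteTopology) {u : S | s * u = s} ⟨u, hu⟩
    (Set.toFinite _).isCompact
    (by
      intro x hx y hy
      change s * (x * y) = s
      rw [← mul_assoc, show s * x = s from hx, show s * y = s from hy])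
  exact ⟨⟨e, hee⟩, he⟩

/-- If `S² = S`, then `s ≤ t ↔ s ∈ t E(S)` is a partial order on `S`. -/
@[reducible]
def naturalOrder {S : Type u} [CommSemigroup S] [Finite S] (h : SquareEqSelf S) :
    PartialOrder S where
  le := NatLE
  le_refl s := by
    obtain ⟨e, he⟩ := exists_idem_mul h s
    exact ⟨e, he.symm⟩
  le_trans := by
    rintro s t w ⟨e, rfl⟩ ⟨f, rfl⟩
    exact ⟨⟨(f : S) * e, f.2.mul e.2⟩, mul_assoc _ _ _⟩
  le_antisymm := by
    rintro s t ⟨e, he⟩ ⟨f, hf⟩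
    have h1 : s * (e : S) = s := by
      rw [he, mul_assoc, show (e : S) * e = e from e.2]
    rw [hf, mul_comm] at he
    have h2 : t * (e : S) = t := by
      rw [hf, mul_right_comm, h1]
    rw [mul_comm, ← hf, h2] at he
    exact he

/-- The Möbius function `μ_S(s, t)` of `S` with respect to the natural partial order. -/
def mobius {S : Type u} [CommSemigroup S] [Fintype S] (h : SquareEqSelf S) (s t : S) : ℤ :=
  letI : PartialOrder S := naturalOrder h
  letI : DecidableLE S := Classical.decRel _
  letI : DecidableLT S := Classical.decRel _
  letI : DecidableEq S := Classical.decEq _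
  letI : LocallyFiniteOrder S := Fintype.toLocallyFiniteOrder
  IncidenceAlgebra.mu ℤ s t

/-! ### Local monoids, maximal subgroups, characters -/

section Local

variable {S : Type u} [CommSemigroup S]

/-- The local monoid `eSe`. -/
def LocalMonoid (e : Idem S) : Type u := Subsemigroup.corner (e : S)

/-- The inclusion `eSe → S`. -/
def LocalMonoid.val {e : Idem S} (s : LocalMonoid e) : S := Subtype.val s

instance (e : Idem S) : CommMonoid (LocalMonoid e) :=
  { (inferInstance : CommSemigroup (Subsemigroup.corner (e : S))) with
    one := ⟨e, e, by
      change (e : S) * e * e = e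
      rw [show (e : S) * e = e from e.2, show (e : S) * e = e from e.2]⟩
    one_mul := fun r => Subtype.ext ((Subsemigroup.mem_corner_iff e.2).mp r.2).1
    mul_one := fun r => Subtype.ext ((Subsemigroup.mem_corner_iff e.2).mp r.2).2 }

instance [Finite S] (e : Idem S) : Finite (LocalMonoid e) :=
  inferInstanceAs (Finite (Subsemigroup.corner (e : S)))

/-- The maximal subgroup `G_e`: the group of units of `eSe`. -/
abbrev MaxSubgroup (e : Idem S) : Type u := (LocalMonoid e)ˣ

instance [Finite S] (e : Idem S) : Fintype (MaxSubgroup e) := Fintype.ofFinite _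

/-- The characters `χ : G_e → ℂˣ`. -/
abbrev Characters (e : Idem S) : Type u := MaxSubgroup e →* ℂˣ

instance [Finite S] (e : Idem S) : Fintype (Characters e) := Fintype.ofFinite _

/-- The class `H̃_e = {s ∈ S ∣ s⁺ = e}`, as a subset of `eSe`, in which it is contained. -/
def HTilde (e : Idem S) : Set (LocalMonoid e) := {s | IsPlus s.val e}

/-- Each `s ∈ S` with `s⁺ = e` belongs to `eSe`. -/
theorem mem_corner_of_isPlus {e : Idem S} {s : S} (h : IsPlus s e) :
    s ∈ Subsemigroup.corner (e : S) := by
  have h1 : s * (e : S) = s := h.1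
  exact (Subsemigroup.mem_corner_iff e.2).mpr ⟨by rw [mul_comm, h1], h1⟩

/-! ### The monoids `H̃_e⁰`, `H̃_e⁰ / I_χ` and `(H̃_e⁰ / I_χ) / G_e` -/

/-- The ideal `I_e = {s ∣ s⁺ < e}` of `eSe`, together with an adjoined zero. -/
def idealBelow [Finite S] (e : Idem S) : SemigroupIdeal (WithZero (LocalMonoid e)) where
  carrier := {0} ∪ {x | ∃ s : LocalMonoid e, x = (s : WithZero (LocalMonoid e)) ∧
    ∃ f : Idem S, IsPlus s.val f ∧ f < e}
  smul_mem' := by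
    rintro y x (hx | ⟨s, rfl, f, hf, hlt⟩)
    · left
      rw [Set.mem_singleton_iff] at hx ⊢
      rw [hx, smul_zero]
    · induction y using WithZero.recZeroCoe with
      | zero => left; exact zero_mul _
      | coe t =>
        right
        refine ⟨t * s, rfl, ?_⟩
        have hfix : (t * s).val * (f : S) = (t * s).val := by
          change t.val * s.val * (f : S) = t.val * s.val
          rw [mul_assoc, show s.val * (f : S) = s.val from hf.1]
        obtain ⟨f', hf'⟩ := exists_isPlus (t * s).val f hfix
        exact ⟨f', hf', lt_of_le_of_lt (hf'.2 hfix) hlt⟩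

/-- The monoid with zero `H̃_e⁰`. Adjoining a zero to `eSe` and collapsing `I_e ∪ {0}` to a point
gives the Rees quotient `eSe / I_e` if `I_e ≠ ∅`, and `eSe = G_e` with an adjoined zero if
`I_e = ∅`. -/
abbrev HTildeZero [Finite S] (e : Idem S) : Type u := ReesQuotient (idealBelow e)

/-- The canonical map `eSe → H̃_e⁰`. -/
def toHTildeZero [Finite S] (e : Idem S) : LocalMonoid e →* HTildeZero e :=
  (ReesQuotient.mk (idealBelow e)).comp
    (WithZero.coeMonoidHom : LocalMonoid e →* WithZero (LocalMonoid e))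

/-- The inclusion of `G_e` in `H̃_e⁰` as its group of units. -/
def unitsToHTildeZero [Finite S] (e : Idem S) : MaxSubgroup e →* HTildeZero e :=
  (toHTildeZero e).comp (Units.coeHom (LocalMonoid e))

/-- The ideal `I_χ` of those `m ∈ H̃_e⁰` whose stabilizer in `G_e` is not contained in `ker χ`. -/
def idealChi [Finite S] (e : Idem S) (χ : Characters e) : SemigroupIdeal (HTildeZero e) where
  carrier := {m | ∃ g : MaxSubgroup e, unitsToHTildeZero e g * m = m ∧ g ∉ χ.ker}
  smul_mem' := by
    rintro x m ⟨g, hg, hχ⟩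
    refine ⟨g, ?_, hχ⟩
    change unitsToHTildeZero e g * (x * m) = x * m
    rw [mul_left_comm, hg]

/-- The monoid `H̃_e⁰ / I_χ` (which is `H̃_e⁰` if `χ` is trivial, as then `I_χ = ∅`). -/
abbrev MChi [Finite S] (e : Idem S) (χ : Characters e) : Type u := ReesQuotient (idealChi e χ)

/-- The canonical homomorphism `G_e → H̃_e⁰ / I_χ`. -/
def unitsToMChi [Finite S] (e : Idem S) (χ : Characters e) : MaxSubgroup e →* MChi e χ :=
  (ReesQuotient.mk (idealChi e χ)).comp (unitsToHTildeZero e)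

/-- The monoid `(H̃_e⁰ / I_χ) / G_e`. -/
abbrev MChiModG [Finite S] (e : Idem S) (χ : Characters e) : Type u :=
  OrbitMonoid (unitsToMChi e χ)

/-- The canonical map `eSe → (H̃_e⁰ / I_χ) / G_e`. -/
def orbitClass [Finite S] (e : Idem S) (χ : Characters e) : LocalMonoid e →* MChiModG e χ :=
  (OrbitMonoid.mk (unitsToMChi e χ)).comp
    ((ReesQuotient.mk (idealChi e χ)).comp (toHTildeZero e))

/-! ### Orbit representatives and the factors -/

/-- `T` is a set of representatives of the orbits of `G_e` on `H̃_e` that contains `e`. -/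
structure IsRepSet (e : Idem S) (T : Set (LocalMonoid e)) : Prop where
  subset : T ⊆ HTilde e
  existsUnique : ∀ s ∈ HTilde e, ∃! t, t ∈ T ∧ t ∈ MulAction.orbit (MaxSubgroup e) s
  one_mem : (1 : LocalMonoid e) ∈ T

/-- `T_{e,χ}`: the elements of `T_e` whose stabilizer in `G_e` is contained in `ker χ`. -/
def repChi {e : Idem S} (T : Set (LocalMonoid e)) (χ : Characters e) : Set (LocalMonoid e) :=
  {t | t ∈ T ∧ MulAction.stabilizer (MaxSubgroup e) t ≤ χ.ker}

instance [Finite S] {e : Idem S} (T : Set (LocalMonoid e)) (χ : Characters e) :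
    Fintype (repChi T χ) := Fintype.ofFinite _

open Classical in
/-- The `T_{e,χ} × T_{e,χ}` matrix `A(χ)`, with `(s, t)` entry `χ(g)` if `st = g s_χ` with
`g ∈ G_e`, and `0` if there is no such `g`; here `sχ` stands for `s_χ`. -/
def matrixA {e : Idem S} (T : Set (LocalMonoid e)) (χ : Characters e) (sχ : LocalMonoid e) :
    Matrix (repChi T χ) (repChi T χ) ℂ :=
  Matrix.of fun s t =>
    if h : ∃ g : MaxSubgroup e, (s : LocalMonoid e) * (t : LocalMonoid e) = g • sχ then
      ((χ h.choose : ℂˣ) : ℂ)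
    else 0

open Classical in
/-- `det A(χ)`. -/
def detA [Finite S] {e : Idem S} (T : Set (LocalMonoid e)) (χ : Characters e)
    (sχ : LocalMonoid e) : ℂ :=
  (matrixA T χ sχ).det

/-- The constant `∏_{s ∈ T_{e,χ}} |G_e s| / |G_e|`. -/
def orbitRatio [Finite S] {e : Idem S} (T : Set (LocalMonoid e)) (χ : Characters e) : ℂ :=
  ∏ s : repChi T χ,
    (Nat.card (MulAction.orbit (MaxSubgroup e) (s : LocalMonoid e)) : ℂ) /
      (Nat.card (MaxSubgroup e) : ℂ)

open Classical in
/-- `y_s = ∑_{t ≤ s} μ_S(t, s) x_t`. -/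
def mobiusForm [Fintype S] (h : SquareEqSelf S) (s : S) : MvPolynomial S ℂ :=
  ∑ t : S with NatLE t s, MvPolynomial.C (mobius h t s : ℂ) * MvPolynomial.X t

/-- The linear form `∑_{g ∈ G_e} conj(χ(g)) ∑_{t ≤ g s_χ} μ_S(t, g s_χ) x_t`. -/
def linearForm [Fintype S] (h : SquareEqSelf S) {e : Idem S} (χ : Characters e)
    (sχ : LocalMonoid e) : MvPolynomial S ℂ :=
  ∑ g : MaxSubgroup e,
    MvPolynomial.C ((starRingEnd ℂ) ((χ g : ℂˣ) : ℂ)) * mobiusForm h (g • sχ).val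

end Local

end SemigroupDet

end

/-!
The semigroup determinant is evaluated at an arbitrary point `x : S → ℂ`, where it is the
determinant of the bilinear form `(s, t) ↦ x(st)` on `ℂS`.

If `s ∉ S²`, a nondegenerate form would represent the functional dual to `s`; as this functional
vanishes on `S²`, nondegeneracy forces it to be zero (`theta_eq_zero`).

Let `S² = S`. Möbius inversion over the natural order changes the basis of `ℂS` to one in which
the product of `u` and `v` is `uv` if `u⁺ = v⁺ = (uv)⁺` and `0` otherwise, because the elements
`w ≤ st` factor uniquely as `(s w⁺)(t w⁺)` (`sum_natLE_mul`). The change of basis has determinant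
`±1` and occurs twice, so `θ_S` is the product over the idempotents `e` of the determinants of the
forms `(u, v) ↦ y_{uv}` on `H̃_e`, with `y_w` read as `0` for `w ∉ H̃_e` (`det_splitMatrix`).

On `H̃_e` the group `G_e` acts. The functions of weight `χ` have a basis indexed by `T_{e,χ}`, and
orthogonality of characters splits the form on `H̃_e` into forms `(s, t) ↦ Φ(st)` on the sets
`T_{e,χ}`, with `Φ` of weight `χ` (`exists_sign_det_form`). The sign is that of the permutation
`(χ, s) ↦ (χ⁻¹, s)`, since the left and right changes of basis use inverse characters.

It remains to study a form of weight `χ`. The elements of `T_{e,χ}` span a commutative local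
algebra whose maximal ideal is spanned by the elements other than `e`. If the form of `Ψ` is
nondegenerate, any other `Φ` is `∑ c_s Ψ(s ·)`, so that the two determinants differ by the
determinant of the multiplication by `∑ c_s s`, which is `c_e ^ |T_{e,χ}|`, whereas
`Φ(a) = c_e Ψ(a)` at every annihilating `a` (`exists_scalar_of_det_ne_zero`). Comparison with the
coordinate function of `a` gives the determinant of every form (`det_formMatrix`), and shows that a
nondegenerate form forces the annihilating element to be unique
(`exists_smul_eq_of_isSocleElement`).
-/

noncomputable section

namespace SemigroupDet

universe u

/-! ### Finite commutative monoids and their semi-invariant functions -/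

/-- In a finite monoid some positive power of each element is idempotent. -/
theorem exists_pow_isIdempotentElem {M : Type u} [Monoid M] [Finite M] (a : M) :
    ∃ n, 0 < n ∧ IsIdempotentElem (a ^ n) := by
  obtain ⟨i, j, hij, h⟩ : ∃ i j : ℕ, i < j ∧ a ^ i = a ^ j := by
    obtain ⟨i, j, hij, h⟩ := Finite.exists_ne_map_eq_of_infinite fun n : ℕ => a ^ n
    rcases lt_or_gt_of_ne hij with hlt | hlt
    · exact ⟨i, j, hlt, h⟩
    · exact ⟨j, i, hlt, h.symm⟩
  obtain ⟨d, hd, rfl⟩ : ∃ d, 0 < d ∧ j = i + d := ⟨j - i, by omega, by omega⟩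
  have periodic : ∀ k m, i ≤ m → a ^ (m + k * d) = a ^ m := by
    intro k
    induction k with
    | zero => simp
    | succ k ih =>
      intro m hm
      obtain ⟨r, rfl⟩ := Nat.exists_eq_add_of_le hm
      rw [show i + r + (k + 1) * d = i + d + r + k * d by ring, ih _ (by omega), pow_add, ← h,
        ← pow_add]
  refine ⟨(i + 1) * d, by positivity, ?_⟩
  rw [IsIdempotentElem, ← pow_add]
  exact periodic _ _ (by nlinarith)

/-- The properties of the subset `H̃_e` of the finite commutative monoid `eSe` on which the
factorization of the determinant rests: its complement is an ideal, and an element that fixes an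
element of `H̃_e` is a unit. -/
structure IsLocalPart {M : Type u} [CommMonoid M] (H : Set M) : Prop where
  of_mul : ∀ {s t : M}, s * t ∈ H → s ∈ H
  isUnit_of_mul_eq : ∀ {s t : M}, s ∈ H → s * t = s → IsUnit t

/-- `T` is a set of representatives of the orbits of the group of units on `H`, with `1 ∈ T`. -/
structure IsTransversal {M : Type u} [CommMonoid M] (H T : Set M) : Prop where
  subset : T ⊆ H
  existsUnique : ∀ s ∈ H, ∃! t, t ∈ T ∧ t ∈ MulAction.orbit Mˣ s
  one_mem : (1 : M) ∈ T

/-- The elements of `H` whose stabilizer is contained in `ker χ`. Semi-invariant functions of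
weight `χ` on `H` vanish outside of this set. -/
def liveSet {M : Type u} [CommMonoid M] (H : Set M) (χ : Mˣ →* ℂˣ) : Set M :=
  {s | s ∈ H ∧ MulAction.stabilizer Mˣ s ≤ χ.ker}

/-- The lifts to `M` of annihilating elements: `s` is live, and its products with nonunits are
not. -/
def IsSocleElement {M : Type u} [CommMonoid M] (H : Set M) (χ : Mˣ →* ℂˣ) (s : M) : Prop :=
  s ∈ liveSet H χ ∧ ∀ t, ¬ IsUnit t → s * t ∉ liveSet H χ

/-- `Φ` is a function of weight `χ` under the group of units, and it vanishes outside of `H`. -/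
structure IsSemiInvariant {M : Type u} [CommMonoid M] (H : Set M) (χ : Mˣ →* ℂˣ) (Φ : M → ℂ) :
    Prop where
  smul : ∀ (g : Mˣ) (m : M), Φ (g • m) = (χ g : ℂ) * Φ m
  eq_zero : ∀ m ∉ H, Φ m = 0

open Classical in
/-- The semi-invariant function that is `χ(g)` at `g s` and vanishes outside of the orbit of `s`. -/
def coordinate {M : Type u} [CommMonoid M] (χ : Mˣ →* ℂˣ) (s m : M) : ℂ :=
  if h : ∃ g : Mˣ, m = g • s then ((χ h.choose : ℂˣ) : ℂ) else 0

section

variable {M : Type u} [CommMonoid M] {H T : Set M} {χ : Mˣ →* ℂˣ} {Φ Ψ : M → ℂ}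

theorem IsLocalPart.smul_mem_iff (hH : IsLocalPart H) (g : Mˣ) (s : M) : g • s ∈ H ↔ s ∈ H := by
  refine ⟨fun h => ?_, fun h => ?_⟩
  · rw [Units.smul_def, smul_eq_mul, mul_comm] at h
    exact hH.of_mul h
  · have : g⁻¹ • g • s ∈ H := by rwa [inv_smul_smul]
    rw [Units.smul_def, smul_eq_mul, mul_comm] at this
    exact hH.of_mul this

theorem smul_mem_liveSet_iff (hH : IsLocalPart H) (g : Mˣ) (s : M) :
    g • s ∈ liveSet H χ ↔ s ∈ liveSet H χ := by
  have : MulAction.stabilizer Mˣ (g • s) = MulAction.stabilizer Mˣ s := by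
    ext k
    simp only [MulAction.mem_stabilizer_iff]
    rw [smul_comm, smul_left_cancel_iff]
  simp only [liveSet, Set.mem_ofPred_eq, this, hH.smul_mem_iff]

theorem IsSemiInvariant.eq_zero_of_notMem_liveSet (hΦ : IsSemiInvariant H χ Φ) {m : M}
    (hm : m ∉ liveSet H χ) : Φ m = 0 := by
  by_cases hmH : m ∈ H
  · obtain ⟨g, hg, hgχ⟩ := SetLike.not_le_iff_exists.mp fun h => hm ⟨hmH, h⟩
    have h := hΦ.smul g m
    rw [MulAction.mem_stabilizer_iff.mp hg] at h
    by_contra hne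
    exact hgχ (Units.ext (mul_right_cancel₀ hne (by simpa using h.symm)))
  · exact hΦ.eq_zero m hmH

theorem coordinate_eq_zero {s m : M} (h : ¬ ∃ g : Mˣ, m = g • s) : coordinate χ s m = 0 :=
  dif_neg h

theorem coordinate_smul_self {s : M} (hs : MulAction.stabilizer Mˣ s ≤ χ.ker) (g : Mˣ) :
    coordinate χ s (g • s) = χ g := by
  have h : ∃ k : Mˣ, g • s = k • s := ⟨g, rfl⟩
  rw [coordinate, dif_pos h]
  have hk : g⁻¹ * h.choose ∈ χ.ker := hs (by
    rw [MulAction.mem_stabilizer_iff, mul_smul, ← h.choose_spec, inv_smul_smul])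
  rw [MonoidHom.mem_ker, map_mul, map_inv, inv_mul_eq_one] at hk
  rw [hk]

theorem coordinate_self {s : M} (hs : MulAction.stabilizer Mˣ s ≤ χ.ker) :
    coordinate χ s s = 1 := by
  simpa using coordinate_smul_self hs 1

theorem isSemiInvariant_coordinate (hH : IsLocalPart H) {s : M} (hs : s ∈ liveSet H χ) :
    IsSemiInvariant H χ (coordinate χ s) where
  smul g m := by
    by_cases h : ∃ k : Mˣ, m = k • s
    · obtain ⟨k, rfl⟩ := h
      rw [← mul_smul, coordinate_smul_self hs.2, coordinate_smul_self hs.2, map_mul, Units.val_mul]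
    · rw [coordinate_eq_zero h, mul_zero, coordinate_eq_zero]
      rintro ⟨k, hk⟩
      exact h ⟨g⁻¹ * k, by rw [mul_smul, ← hk, inv_smul_smul]⟩
  eq_zero m hm := coordinate_eq_zero (by
    rintro ⟨k, rfl⟩
    exact hm ((hH.smul_mem_iff k s).mpr hs.1))

/-- The orbit representatives that lie in the live set. -/
abbrev liveReps (T : Set M) (χ : Mˣ →* ℂˣ) : Set M :=
  {t | t ∈ T ∧ MulAction.stabilizer Mˣ t ≤ χ.ker}

instance [Finite M] (T : Set M) (χ : Mˣ →* ℂˣ) : Fintype (liveReps T χ) := Fintype.ofFinite _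

theorem IsTransversal.liveReps_subset (hT : IsTransversal H T) : liveReps T χ ⊆ liveSet H χ :=
  fun _ ht => ⟨hT.subset ht.1, ht.2⟩

theorem IsTransversal.eq_of_smul_eq (hT : IsTransversal H T) {s t : M} (hs : s ∈ T) (ht : t ∈ T)
    (g : Mˣ) (h : t = g • s) : t = s :=
  (hT.existsUnique s (hT.subset hs)).unique ⟨ht, g, h.symm⟩ ⟨hs, MulAction.mem_orbit_self s⟩

theorem IsTransversal.exists_smul_eq (hT : IsTransversal H T) (hH : IsLocalPart H) {m : M}
    (hm : m ∈ liveSet H χ) : ∃ t ∈ liveReps T χ, ∃ g : Mˣ, m = g • t := by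
  obtain ⟨t, ⟨htT, g, hg⟩, -⟩ := hT.existsUnique m hm.1
  change g • m = t at hg
  refine ⟨t, ⟨htT, ?_⟩, g⁻¹, by rw [← hg, inv_smul_smul]⟩
  rw [← hg]
  exact ((smul_mem_liveSet_iff hH g m).mpr hm).2

theorem IsTransversal.coordinate_of_ne (hT : IsTransversal H T) {s t : M} (hs : s ∈ T)
    (ht : t ∈ T) (h : t ≠ s) (g : Mˣ) : coordinate χ s (g • t) = 0 :=
  coordinate_eq_zero (by
    rintro ⟨k, hk⟩
    exact h (hT.eq_of_smul_eq hs ht (g⁻¹ * k) (by rw [mul_smul, ← hk, inv_smul_smul])))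

theorem IsTransversal.not_isUnit (hT : IsTransversal H T) {s : M} (hs : s ∈ T) (h : s ≠ 1) :
    ¬ IsUnit s := by
  rintro ⟨g, rfl⟩
  exact h (hT.eq_of_smul_eq hT.one_mem hs g (by rw [Units.smul_def, smul_eq_mul, mul_one]))

theorem stabilizer_one_le : MulAction.stabilizer Mˣ (1 : M) ≤ χ.ker := by
  intro g hg
  rw [MulAction.mem_stabilizer_iff, Units.smul_def, smul_eq_mul, mul_one] at hg
  rw [show g = 1 from Units.ext hg]
  exact one_mem _

theorem IsSemiInvariant.mul_left (hΦ : IsSemiInvariant H χ Φ) (hH : IsLocalPart H) (r : M) :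
    IsSemiInvariant H χ fun m => Φ (r * m) where
  smul g m := by
    rw [← hΦ.smul]
    congr 1
    simp only [Units.smul_def, smul_eq_mul]
    exact mul_left_comm _ _ _
  eq_zero m hm := hΦ.eq_zero _ fun h => hm (hH.of_mul (by rwa [mul_comm] at h))

/-! ### Determinants of semi-invariant forms -/

/-- The matrix of the bilinear form `(s, t) ↦ Φ(st)`. -/
def formMatrix (T : Set M) (χ : Mˣ →* ℂˣ) (Φ : M → ℂ) :
    Matrix (liveReps T χ) (liveReps T χ) ℂ :=
  Matrix.of fun s t => Φ (s.1 * t.1)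

/-- The matrix of the translation of semi-invariant functions by `m`. -/
def translationMatrix (T : Set M) (χ : Mˣ →* ℂˣ) (m : M) :
    Matrix (liveReps T χ) (liveReps T χ) ℂ :=
  Matrix.of fun r q => coordinate χ q.1 (m * r.1)

open Classical in
theorem translationMatrix_one (hT : IsTransversal H T) : translationMatrix T χ 1 = 1 := by
  ext r q
  rw [translationMatrix, Matrix.of_apply, one_mul, Matrix.one_apply]
  split_ifs with h
  · rw [h, coordinate_self q.2.2]
  · simpa using hT.coordinate_of_ne (χ := χ) q.2.1 r.2.1 (fun h' => h (Subtype.ext h')) 1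

variable [Finite M]

/-- The functions `coordinate χ q`, `q ∈ T_χ`, form a basis of the space of semi-invariant
functions, dual to evaluation at the points of `T_χ`. -/
theorem IsSemiInvariant.eq_sum_coordinate (hΦ : IsSemiInvariant H χ Φ) (hH : IsLocalPart H)
    (hT : IsTransversal H T) (m : M) :
    Φ m = ∑ q : liveReps T χ, coordinate χ q.1 m * Φ q.1 := by
  by_cases hm : m ∈ liveSet H χ
  · obtain ⟨t, ht, g, rfl⟩ := hT.exists_smul_eq hH hm
    rw [Finset.sum_eq_single (⟨t, ht⟩ : liveReps T χ)]
    · rw [coordinate_smul_self ht.2, hΦ.smul]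
    · intro q _ hq
      rw [hT.coordinate_of_ne q.2.1 ht.1 (fun h => hq (Subtype.ext h.symm)), zero_mul]
    · simp
  · rw [hΦ.eq_zero_of_notMem_liveSet hm, Finset.sum_eq_zero]
    intro q _
    rw [(isSemiInvariant_coordinate hH (hT.liveReps_subset q.2)).eq_zero_of_notMem_liveSet hm,
      zero_mul]

theorem translationMatrix_mul (hH : IsLocalPart H) (hT : IsTransversal H T) (m n : M) :
    translationMatrix T χ (m * n) = translationMatrix T χ m * translationMatrix T χ n := by
  ext r q
  rw [Matrix.mul_apply]
  have h := ((isSemiInvariant_coordinate hH (hT.liveReps_subset q.2)).mul_left hH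
    n).eq_sum_coordinate hH hT (m * r.1)
  simp only [translationMatrix, Matrix.of_apply]
  rw [← h, mul_comm m n, mul_assoc]

theorem translationMatrix_mul_formMatrix (hH : IsLocalPart H) (hT : IsTransversal H T)
    (hΦ : IsSemiInvariant H χ Φ) (m : M) :
    translationMatrix T χ m * formMatrix T χ Φ = formMatrix T χ fun n => Φ (m * n) := by
  ext r t
  rw [Matrix.mul_apply]
  have h := (hΦ.mul_left hH t.1).eq_sum_coordinate hH hT (m * r.1)
  simp only [translationMatrix, formMatrix, Matrix.of_apply]
  rw [show m * (r.1 * t.1) = t.1 * (m * r.1) by rw [← mul_assoc, mul_comm], h]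
  exact Finset.sum_congr rfl fun q _ => by rw [mul_comm t.1]

open Classical in
theorem isNilpotent_translationMatrix (hH : IsLocalPart H) (hT : IsTransversal H T) {m : M}
    (hm : ¬ IsUnit m) : IsNilpotent (translationMatrix T χ m) := by
  obtain ⟨n, hn, hid⟩ := exists_pow_isIdempotentElem m
  have hpow : ∀ k, translationMatrix T χ (m ^ k) = translationMatrix T χ m ^ k := by
    intro k
    induction k with
    | zero => rw [pow_zero, pow_zero, translationMatrix_one hT]
    | succ k ih => rw [pow_succ, pow_succ, translationMatrix_mul hH hT, ih]
  refine ⟨n, ?_⟩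
  rw [← hpow]
  ext r q
  refine (isSemiInvariant_coordinate hH (hT.liveReps_subset q.2)).eq_zero _ fun h => hm ?_
  refine (isUnit_pow_iff hn.ne').mp (hH.isUnit_of_mul_eq h ?_)
  rw [mul_right_comm, hid.eq]

open Classical in
/-- A nondegenerate form `Ψ` generates all others: `Φ(m) = ∑ c_s Ψ(s m)`. In the local algebra
spanned by `T_χ`, the element `∑ c_s s` is the scalar `c = c_1` plus a nilpotent, whence the two
relations. -/
theorem exists_scalar_of_det_ne_zero (hH : IsLocalPart H) (hT : IsTransversal H T)
    (hΦ : IsSemiInvariant H χ Φ) (hΨ : IsSemiInvariant H χ Ψ)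
    (h : (formMatrix T χ Ψ).det ≠ 0) :
    ∃ c : ℂ, (formMatrix T χ Φ).det = c ^ Nat.card (liveReps T χ) * (formMatrix T χ Ψ).det ∧
      ∀ a, IsSocleElement H χ a → Φ a = c * Ψ a := by
  obtain ⟨c, hc⟩ : ∃ c : liveReps T χ → ℂ, ∀ t : liveReps T χ, ∑ s, c s * Ψ (s.1 * t.1) = Φ t.1 := by
    refine ⟨Matrix.vecMul (fun t => Φ t.1) (formMatrix T χ Ψ)⁻¹, fun t => ?_⟩
    have := Matrix.vecMul_vecMul (fun t : liveReps T χ => Φ t.1) (formMatrix T χ Ψ)⁻¹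
      (formMatrix T χ Ψ)
    rw [Matrix.nonsing_inv_mul _ (isUnit_iff_ne_zero.mpr h), Matrix.vecMul_one] at this
    exact congrFun this t
  have hcm : ∀ m, Φ m = ∑ s, c s * Ψ (s.1 * m) := by
    intro m
    rw [hΦ.eq_sum_coordinate hH hT m]
    have h2 : ∀ s : liveReps T χ, Ψ (s.1 * m) =
        ∑ q : liveReps T χ, coordinate χ q.1 m * Ψ (s.1 * q.1) :=
      fun s => (hΨ.mul_left hH s.1).eq_sum_coordinate hH hT m
    simp only [h2, ← hc, Finset.mul_sum]
    rw [Finset.sum_comm]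
    exact Finset.sum_congr rfl fun _ _ => Finset.sum_congr rfl fun _ _ => by ring
  let one : liveReps T χ := ⟨1, hT.one_mem, stabilizer_one_le⟩
  have hne : ∀ s ∈ Finset.univ.erase one, ¬ IsUnit s.1 := fun s hs =>
    hT.not_isUnit s.2.1 fun h1 => Finset.ne_of_mem_erase hs (Subtype.ext h1)
  refine ⟨c one, ?_, fun a ha => ?_⟩
  · let N := ∑ s ∈ Finset.univ.erase one, c s • translationMatrix T χ s.1
    have hN : IsNilpotent N := by
      refine Commute.isNilpotent_sum (fun s hs => ?_) fun s t _ _ => ?_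
      · exact (isNilpotent_translationMatrix hH hT (hne s hs)).smul _
      · refine Commute.smul_left (Commute.smul_right ?_ _) _
        rw [commute_iff_eq, ← translationMatrix_mul hH hT, ← translationMatrix_mul hH hT, mul_comm]
    have hdet : (c one • (1 : Matrix (liveReps T χ) (liveReps T χ) ℂ) + N).det =
        c one ^ Nat.card (liveReps T χ) := by
      have h1 := (Matrix.isNilpotent_charpoly_sub_pow_of_isNilpotent hN.neg).eq_zero
      have h2 := congrArg (Polynomial.eval (c one)) (sub_eq_zero.mp h1)
      rw [Matrix.eval_charpoly, sub_neg_eq_add, Polynomial.eval_pow, Polynomial.eval_X] at h2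
      rw [Nat.card_eq_fintype_card, ← h2, Matrix.scalar_apply, Matrix.smul_one_eq_diagonal]
    have hprod : formMatrix T χ Φ = (c one • 1 + N) * formMatrix T χ Ψ := by
      have hsum : c one • 1 + N = ∑ s : liveReps T χ, c s • translationMatrix T χ s.1 := by
        rw [← Finset.add_sum_erase _ _ (Finset.mem_univ one), translationMatrix_one hT]
      rw [hsum, Finset.sum_mul]
      ext r t
      rw [Matrix.sum_apply, formMatrix, Matrix.of_apply, hcm]
      refine Finset.sum_congr rfl fun s _ => ?_
      rw [Matrix.smul_mul, translationMatrix_mul_formMatrix hH hT hΨ]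
      rfl
    rw [hprod, Matrix.det_mul, hdet]
  · rw [hcm, ← Finset.add_sum_erase _ _ (Finset.mem_univ one), one_mul, Finset.sum_eq_zero,
      add_zero]
    intro s hs
    rw [mul_comm s.1, hΨ.eq_zero_of_notMem_liveSet (ha.2 _ (hne s hs)), mul_zero]

open Classical in
/-- The determinant of a semi-invariant form depends only on its value at a socle element `a`. -/
theorem det_formMatrix (hH : IsLocalPart H) (hT : IsTransversal H T)
    (hΦ : IsSemiInvariant H χ Φ) {a : M} (ha : IsSocleElement H χ a) :
    (formMatrix T χ Φ).det =
      (formMatrix T χ (coordinate χ a)).det * Φ a ^ Nat.card (liveReps T χ) := by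
  have hc := isSemiInvariant_coordinate hH ha.1
  have ha1 : coordinate χ a a = 1 := coordinate_self ha.1.2
  by_cases hA : (formMatrix T χ (coordinate χ a)).det = 0
  · rw [hA, zero_mul]
    by_contra hΦ0
    obtain ⟨c, hdet, hval⟩ := exists_scalar_of_det_ne_zero hH hT hc hΦ hΦ0
    -- `c` would have to vanish, but the coordinate function takes the value `1` at `a`.
    rw [hA, zero_eq_mul, or_iff_left hΦ0] at hdet
    have := hval a ha
    rw [eq_zero_of_pow_eq_zero hdet, zero_mul, ha1] at this
    exact one_ne_zero this
  · obtain ⟨c, hdet, hval⟩ := exists_scalar_of_det_ne_zero hH hT hΦ hc hA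
    rw [hdet, hval a ha, ha1, mul_one, mul_comm]

open Classical in
/-- If some semi-invariant form is nondegenerate, the socle elements form a single orbit. -/
theorem exists_smul_eq_of_isSocleElement (hH : IsLocalPart H) (hT : IsTransversal H T)
    (hΦ : IsSemiInvariant H χ Φ) (h : (formMatrix T χ Φ).det ≠ 0) {a b : M}
    (ha : IsSocleElement H χ a) (hb : IsSocleElement H χ b) : ∃ g : Mˣ, b = g • a := by
  by_contra hab
  obtain ⟨c, -, hval⟩ :=
    exists_scalar_of_det_ne_zero hH hT (isSemiInvariant_coordinate hH ha.1) hΦ h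
  obtain ⟨d, -, hval'⟩ :=
    exists_scalar_of_det_ne_zero hH hT (isSemiInvariant_coordinate hH hb.1) hΦ h
  have h1 := hval a ha
  have h2 := hval b hb
  have h3 := hval' b hb
  rw [coordinate_self ha.1.2] at h1
  rw [coordinate_eq_zero hab, zero_eq_mul] at h2
  rw [coordinate_self hb.1.2] at h3
  rcases h2 with h2 | h2
  · rw [h2, zero_mul] at h1
    exact one_ne_zero h1
  · rw [h2, mul_zero] at h3
    exact one_ne_zero h3

/-- Every live set that is nonempty contains a socle element: multiply by nonunits for as long
as the product stays live. -/
theorem exists_isSocleElement (hH : IsLocalPart H) (h : (liveSet H χ).Nonempty) :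
    ∃ a, IsSocleElement H χ a := by
  obtain ⟨a, ha, hmin⟩ := (Set.toFinite (liveSet H χ)).exists_minimalFor
    (fun s => Set.range fun m : M => s * m) _ h
  refine ⟨a, ha, fun t ht hat => ht ?_⟩
  have hle : (Set.range fun m : M => a * t * m) ≤ Set.range fun m : M => a * m := by
    rintro _ ⟨m, rfl⟩
    exact ⟨t * m, (mul_assoc _ _ _).symm⟩
  obtain ⟨m, hm⟩ := hmin hat hle ⟨1, rfl⟩
  refine isUnit_of_mul_isUnit_left (y := m) (hH.isUnit_of_mul_eq ha.1 ?_)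
  simpa [mul_assoc] using hm

end

open Classical in
/-- The orbit of `1` is represented by `1`, every other orbit by an arbitrary choice. -/
theorem exists_isTransversal {M : Type u} [CommMonoid M] {H : Set M} (hH : IsLocalPart H)
    (h1 : (1 : M) ∈ H) : ∃ T, IsTransversal H T := by
  let q : M → MulAction.orbitRel.Quotient Mˣ M := Quotient.mk''
  let rep : M → M := fun s => if IsUnit s then 1 else (q s).out
  have hrep : ∀ s, rep s ∈ MulAction.orbit Mˣ s := by
    intro s
    by_cases hs : IsUnit s
    · obtain ⟨g, rfl⟩ := hs
      exact ⟨g⁻¹, by simp [rep, Units.smul_def]⟩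
    · simp only [rep, if_neg hs]
      exact MulAction.orbitRel_apply.mp (Quotient.exact (Quotient.out_eq (q s)))
  have hconst : ∀ s t, t ∈ MulAction.orbit Mˣ s → rep t = rep s := by
    rintro s _ ⟨g, rfl⟩
    have hq : q (g • s) = q s := Quotient.sound' ⟨g, rfl⟩
    have hu : IsUnit (g • s) ↔ IsUnit s := by
      rw [Units.smul_def, smul_eq_mul, Units.isUnit_units_mul]
    simp only [rep, hq, hu]
  refine ⟨{s | s ∈ H ∧ rep s = s}, fun s hs => hs.1, fun s hs => ?_, h1, if_pos isUnit_one⟩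
  refine ⟨rep s, ⟨⟨?_, hconst _ _ (hrep s)⟩, hrep s⟩, fun t ht => ?_⟩
  · obtain ⟨g, hg⟩ := hrep s
    rw [← hg]
    exact (hH.smul_mem_iff g s).mpr hs
  · rw [← ht.1.2]
    exact hconst _ _ ht.2

/-! ### Block diagonal matrices -/

theorem det_blockDiagonal_sigma {o R : Type*} {n : o → Type*} [Fintype o] [DecidableEq o]
    [∀ i, Fintype (n i)] [∀ i, DecidableEq (n i)] [CommRing R]
    (B : (i : o) → Matrix (n i) (n i) R) :
    (Matrix.blockDiagonal' B).det = ∏ i, (B i).det := by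
  let _ : LinearOrder o := LinearOrder.lift' (Fintype.equivFin o) (Fintype.equivFin o).injective
  rw [(Matrix.blockTriangular_blockDiagonal' B).det_fintype]
  refine Finset.prod_congr rfl fun i _ => ?_
  rw [← Matrix.det_submatrix_equiv_self (Equiv.sigmaSubtype (β := n) i).symm]
  congr 1
  ext s t
  exact Matrix.blockDiagonal'_apply_eq B i s t

/-! ### Decomposition of a form under the group of units -/

section

variable {M : Type u} [CommMonoid M] {H T : Set M}

/-- The component of weight `χ` of the function `F`, up to the factor `|Mˣ|`. -/
def isotypic [Fintype Mˣ] (χ : Mˣ →* ℂˣ) (F : M → ℂ) (m : M) : ℂ :=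
  ∑ g : Mˣ, ((χ⁻¹ g : ℂˣ) : ℂ) * F (g • m)

theorem isSemiInvariant_isotypic [Fintype Mˣ] (hH : IsLocalPart H) (χ : Mˣ →* ℂˣ) {F : M → ℂ}
    (hF : ∀ m ∉ H, F m = 0) : IsSemiInvariant H χ (isotypic χ F) where
  smul g m := by
    rw [isotypic, isotypic, Finset.mul_sum]
    refine Fintype.sum_equiv (Equiv.mulRight g) _ _ fun k => ?_
    simp only [Equiv.coe_mulRight, map_mul, MonoidHom.inv_apply, mul_smul, Units.val_mul]
    rw [← mul_assoc]
    congr 1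
    rw [mul_left_comm, ← Units.val_mul (χ g), mul_inv_cancel, Units.val_one, mul_one]
  eq_zero m hm := Finset.sum_eq_zero fun g _ => by
    rw [hF _ fun h => hm ((hH.smul_mem_iff g m).mp h), mul_zero]

/-- The proportion `|Mˣ s| / |Mˣ|`. -/
def orbitProportion (s : M) : ℂ :=
  (Nat.card (MulAction.orbit Mˣ s) : ℂ) / (Nat.card Mˣ : ℂ)

theorem orbitProportion_ne_zero [Finite M] (s : M) : orbitProportion s ≠ 0 :=
  have : Nonempty (MulAction.orbit Mˣ s) := ⟨⟨s, MulAction.mem_orbit_self s⟩⟩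
  div_ne_zero (Nat.cast_ne_zero.mpr Nat.card_pos.ne') (Nat.cast_ne_zero.mpr Nat.card_pos.ne')

theorem card_smul_eq [Finite M] (s : M) (g : Mˣ) :
    Nat.card {k : Mˣ // g • s = k • s} = Nat.card (MulAction.stabilizer Mˣ s) := by
  refine Nat.card_congr ((Equiv.mulLeft g⁻¹).subtypeEquiv fun k => ?_)
  rw [Equiv.coe_mulLeft, MulAction.mem_stabilizer_iff, mul_smul, inv_smul_eq_iff, eq_comm]

theorem orbitProportion_mul_card_stabilizer [Finite M] (s : M) :
    orbitProportion s * (Nat.card (MulAction.stabilizer Mˣ s) : ℂ) = 1 := by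
  have h : Nat.card (MulAction.orbit Mˣ s) * Nat.card (MulAction.stabilizer Mˣ s) = Nat.card Mˣ := by
    rw [← Nat.card_prod]
    exact Nat.card_congr (MulAction.orbitProdStabilizerEquivGroup Mˣ s)
  rw [orbitProportion, div_mul_eq_mul_div, ← Nat.cast_mul, h,
    div_self (Nat.cast_ne_zero.mpr Nat.card_pos.ne')]

open Classical in
theorem sum_coordinate_mul [Finite M] [Fintype H] [Fintype Mˣ] (hH : IsLocalPart H)
    {χ : Mˣ →* ℂˣ} {s : M} (hs : s ∈ liveSet H χ) (f : M → ℂ) :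
    ∑ u : H, coordinate χ s u.1 * f u.1 =
      orbitProportion s * ∑ g : Mˣ, (χ g : ℂ) * f (g • s) := by
  let ψ : Mˣ → H := fun g => ⟨g • s, (hH.smul_mem_iff g s).mpr hs.1⟩
  have h1 : ∑ g : Mˣ, (χ g : ℂ) * f (g • s) =
      ∑ g : Mˣ, coordinate χ s (ψ g).1 * f (ψ g).1 :=
    Finset.sum_congr rfl fun g _ => by rw [coordinate_smul_self hs.2]
  rw [h1, ← Finset.sum_fiberwise Finset.univ ψ, Finset.mul_sum]
  refine Finset.sum_congr rfl fun u _ => ?_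
  have h2 : ∀ g ∈ Finset.univ.filter (fun g => ψ g = u),
      coordinate χ s (ψ g).1 * f (ψ g).1 = coordinate χ s u.1 * f u.1 := by
    intro g hg
    rw [(Finset.mem_filter.mp hg).2]
  rw [Finset.sum_congr rfl h2, Finset.sum_const, nsmul_eq_mul]
  by_cases h : ∃ g : Mˣ, u.1 = g • s
  · obtain ⟨g, hg⟩ := h
    have h3 : (Finset.univ.filter (fun k => ψ k = u)).card =
        Nat.card (MulAction.stabilizer Mˣ s) := by
      rw [← card_smul_eq s g, Nat.card_eq_fintype_card, Fintype.card_subtype]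
      congr 1
      ext k
      simp only [Finset.mem_filter, Finset.mem_univ, true_and, ψ, Subtype.ext_iff, hg, eq_comm]
    rw [h3, ← mul_assoc, orbitProportion_mul_card_stabilizer, one_mul]
  · rw [coordinate_eq_zero h]
    ring

open Classical in
theorem sum_character_mul [Finite M] [Fintype Mˣ] (χ ψ : Mˣ →* ℂˣ) :
    ∑ g : Mˣ, (χ g : ℂ) * ((ψ⁻¹ g : ℂˣ) : ℂ) = if χ = ψ then (Nat.card Mˣ : ℂ) else 0 := by
  have h := sum_hom_units ((Units.coeHom ℂ).comp (χ * ψ⁻¹))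
  have h1 : (Units.coeHom ℂ).comp (χ * ψ⁻¹) = 1 ↔ χ = ψ := by
    rw [← mul_inv_eq_one (a := χ), MonoidHom.ext_iff, MonoidHom.ext_iff]
    simp [Units.ext_iff]
  simp only [h1] at h
  rw [Nat.card_eq_fintype_card]
  push_cast at h
  rw [← h]
  simp

theorem card_characters_stabilizer [Finite M] (s : M) :
    Nat.card {χ : Mˣ →* ℂˣ // MulAction.stabilizer Mˣ s ≤ χ.ker} =
      Nat.card (MulAction.orbit Mˣ s) := by
  rw [Nat.card_congr (MulAction.orbitEquivQuotientStabilizer Mˣ s),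
    ← CommGroup.card_domRestrictHom_ker ℂ (MulAction.stabilizer Mˣ s)]
  refine Nat.card_congr (Equiv.subtypeEquivRight fun χ => ?_)
  rw [MonoidHom.mem_ker, MonoidHom.domRestrictHom_apply, MonoidHom.domRestrict_eq_one_iff]
  rfl

/-- There are as many pairs of a character `χ` and an element of `T_χ` as elements of `H`. -/
theorem card_sigma_liveReps [Finite M] (hH : IsLocalPart H) (hT : IsTransversal H T) :
    Nat.card (Σ χ : Mˣ →* ℂˣ, liveReps T χ) = Nat.card H := by
  let e1 : (Σ χ : Mˣ →* ℂˣ, liveReps T χ) ≃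
      Σ t : T, {χ : Mˣ →* ℂˣ // MulAction.stabilizer Mˣ t.1 ≤ χ.ker} :=
    { toFun := fun x => ⟨⟨x.2.1, x.2.2.1⟩, ⟨x.1, x.2.2.2⟩⟩
      invFun := fun x => ⟨x.2.1, ⟨x.1.1, x.1.2, x.2.2⟩⟩
      left_inv := fun _ => rfl
      right_inv := fun _ => rfl }
  let f : (Σ t : T, MulAction.orbit Mˣ t.1) → H := fun x => ⟨x.2.1, by
    obtain ⟨g, hg⟩ := x.2.2
    rw [← hg]
    exact (hH.smul_mem_iff g _).mpr (hT.subset x.1.2)⟩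
  have hf : Function.Bijective f := by
    constructor
    · rintro ⟨s, u, g, hg⟩ ⟨t, v, k, hk⟩ h
      have huv : u = v := congrArg Subtype.val h
      subst huv
      have hst : t = s := Subtype.ext (hT.eq_of_smul_eq s.2 t.2 (k⁻¹ * g) (by
        change g • s.1 = u at hg
        change k • t.1 = u at hk
        rw [mul_smul, hg, ← hk, inv_smul_smul]))
      subst hst
      rfl
    · rintro ⟨u, hu⟩
      obtain ⟨t, ⟨ht, hto⟩, -⟩ := hT.existsUnique u hu
      exact ⟨⟨⟨t, ht⟩, ⟨u, MulAction.mem_orbit_symm.mp hto⟩⟩, rfl⟩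
  have := Fintype.ofFinite T
  rw [Nat.card_congr e1, ← Nat.card_congr (Equiv.ofBijective f hf), Nat.card_sigma, Nat.card_sigma]
  exact Finset.sum_congr rfl fun t _ => card_characters_stabilizer t.1

theorem liveReps_inv (χ : Mˣ →* ℂˣ) : liveReps T χ⁻¹ = liveReps T χ := by
  ext t
  have : χ⁻¹.ker = χ.ker := by
    ext g
    simp [MonoidHom.mem_ker]
  simp only [liveReps, Set.mem_ofPred_eq, this]

theorem liveSet_inv (χ : Mˣ →* ℂˣ) : liveSet H χ⁻¹ = liveSet H χ := by
  ext t
  have : χ⁻¹.ker = χ.ker := by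
    ext g
    simp [MonoidHom.mem_ker]
  simp only [liveSet, Set.mem_ofPred_eq, this]

/-- The permutation `(χ, s) ↦ (χ⁻¹, s)`, whose sign is that of the factorization. -/
def invCharacterPerm (T : Set M) : Equiv.Perm (Σ χ : Mˣ →* ℂˣ, liveReps T χ) :=
  Function.Involutive.toPerm
    (fun x => ⟨x.1⁻¹, ⟨x.2.1, by rw [liveReps_inv]; exact x.2.2⟩⟩)
    (by
      rintro ⟨χ, s, hs⟩
      refine Sigma.ext (inv_inv χ) ((Subtype.heq_iff_coe_eq fun t => ?_).mpr rfl)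
      change t ∈ liveReps T χ⁻¹⁻¹ ↔ t ∈ liveReps T χ
      rw [liveReps_inv, liveReps_inv])

open Classical in
/-- A form `(u, v) ↦ F(uv)` on `H` splits into forms on the sets `T_χ`. Let `D` be the matrix of
the values of the functions `coordinate χ s`, and `E` the same matrix for the inverse characters.
Orthogonality of characters gives that `E Y Eᵀ` is block diagonal, for `Y` the matrix of the form,
and that `D Eᵀ` is diagonal. Since `E` is `D` with permuted rows, `(det E)²` is known up to sign. -/
theorem exists_sign_det_form [Finite M] [Fintype H] [Fintype Mˣ] [Fintype (Mˣ →* ℂˣ)]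
    (hH : IsLocalPart H) (hT : IsTransversal H T) :
    ∃ ε : ℤˣ, ∀ F : M → ℂ, (∀ m ∉ H, F m = 0) →
      (Matrix.of fun u v : H => F (u.1 * v.1)).det =
        ((ε : ℤ) : ℂ) * ∏ χ : Mˣ →* ℂˣ, (∏ s : liveReps T χ, orbitProportion s.1) *
          (formMatrix T χ (isotypic χ F)).det := by
  let ι := Σ χ : Mˣ →* ℂˣ, liveReps T χ
  obtain ⟨φ⟩ : Nonempty (ι ≃ H) := Finite.card_eq.mp (card_sigma_liveReps hH hT)
  let n : ℂ := Nat.card Mˣ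
  have hn : n ≠ 0 := Nat.cast_ne_zero.mpr Nat.card_pos.ne'
  let D : Matrix ι ι ℂ := Matrix.of fun i j => coordinate i.1 i.2.1 (φ j).1
  let E : Matrix ι ι ℂ := Matrix.of fun i j => coordinate i.1⁻¹ i.2.1 (φ j).1
  have hED : E = D.submatrix (invCharacterPerm T) id := rfl
  have hlive : ∀ i : ι, i.2.1 ∈ liveSet H i.1 := fun i => hT.liveReps_subset i.2.2
  have hlive' : ∀ i : ι, i.2.1 ∈ liveSet H i.1⁻¹ := fun i => by
    rw [liveSet_inv]; exact hlive i
  have hDE : D * E.transpose = Matrix.diagonal fun i : ι => orbitProportion i.2.1 * n := by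
    ext i j
    rw [Matrix.mul_apply]
    simp only [D, E, Matrix.of_apply, Matrix.transpose_apply]
    rw [φ.sum_comp fun u : H => coordinate i.1 i.2.1 u.1 * coordinate j.1⁻¹ j.2.1 u.1,
      sum_coordinate_mul hH (hlive i), Matrix.diagonal_apply]
    by_cases hst : i.2.1 = j.2.1
    · have h1 : ∀ g : Mˣ, coordinate j.1⁻¹ j.2.1 (g • i.2.1) = ((j.1⁻¹ g : ℂˣ) : ℂ) := by
        intro g
        rw [hst, coordinate_smul_self (hlive' j).2]
      simp only [h1]
      rw [sum_character_mul]
      have h2 : i = j ↔ i.1 = j.1 := by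
        refine ⟨fun h => by rw [h], fun h => ?_⟩
        obtain ⟨χ, s⟩ := i
        obtain ⟨ψ, t⟩ := j
        change χ = ψ at h
        subst h
        exact congrArg (Sigma.mk χ) (Subtype.ext hst)
      simp only [h2]
      split_ifs
      · rfl
      · rw [mul_zero]
    · rw [if_neg fun h => hst (by rw [h])]
      rw [Finset.sum_eq_zero, mul_zero]
      intro g _
      rw [hT.coordinate_of_ne j.2.2.1 i.2.2.1 hst, mul_zero]
  have hEdet : E.det = ((Equiv.Perm.sign (invCharacterPerm T) : ℤ) : ℂ) * D.det := by
    rw [hED, Matrix.det_permute]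
  let ε : ℤˣ := Equiv.Perm.sign (invCharacterPerm T)
  have hε : ((ε : ℤ) : ℂ) * ((ε : ℤ) : ℂ) = 1 := by
    rw [← Int.cast_mul, ← Units.val_mul, Int.units_mul_self, Units.val_one, Int.cast_one]
  have hE2 : E.det * E.det = ((ε : ℤ) : ℂ) * ∏ i : ι, (orbitProportion i.2.1 * n) := by
    rw [← Matrix.det_diagonal, ← hDE, Matrix.det_mul, Matrix.det_transpose, ← mul_assoc, ← hEdet]
  have hne : ∏ i : ι, (orbitProportion i.2.1 * n) ≠ 0 :=
    Finset.prod_ne_zero_iff.mpr fun i _ => mul_ne_zero (orbitProportion_ne_zero _) hn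
  refine ⟨ε, fun F hF => ?_⟩
  let Y : Matrix ι ι ℂ := Matrix.of fun i j => F ((φ i).1 * (φ j).1)
  have hY : (Matrix.of fun u v : H => F (u.1 * v.1)).det = Y.det :=
    (Matrix.det_submatrix_equiv_self φ (Matrix.of fun u v : H => F (u.1 * v.1))).symm
  let B : (χ : Mˣ →* ℂˣ) → Matrix (liveReps T χ) (liveReps T χ) ℂ := fun χ =>
    Matrix.diagonal (fun s => orbitProportion s.1 * n) * formMatrix T χ (isotypic χ F) *
      Matrix.diagonal fun s => orbitProportion s.1
  have hEY : ∀ i j, (E * Y) i j = orbitProportion i.2.1 * isotypic i.1 F (i.2.1 * (φ j).1) := by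
    intro i j
    rw [Matrix.mul_apply]
    simp only [E, Y, Matrix.of_apply]
    rw [φ.sum_comp fun u : H => coordinate i.1⁻¹ i.2.1 u.1 * F (u.1 * (φ j).1),
      sum_coordinate_mul hH (hlive' i) fun u => F (u * (φ j).1), isotypic]
    simp only [smul_mul_assoc]
  have hB : E * Y * E.transpose = Matrix.blockDiagonal' B := by
    ext i j
    rw [Matrix.mul_apply]
    simp only [hEY, E, Matrix.of_apply, Matrix.transpose_apply]
    rw [φ.sum_comp fun u : H => orbitProportion i.2.1 * isotypic i.1 F (i.2.1 * u.1) *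
      coordinate j.1⁻¹ j.2.1 u.1]
    simp only [mul_comm _ (coordinate _ _ _)]
    rw [sum_coordinate_mul hH (hlive' j) fun u =>
      orbitProportion i.2.1 * isotypic i.1 F (i.2.1 * u)]
    have h1 : ∀ g : Mˣ, ((j.1⁻¹ g : ℂˣ) : ℂ) *
        (orbitProportion i.2.1 * isotypic i.1 F (i.2.1 * g • j.2.1)) =
        (i.1 g : ℂ) * ((j.1⁻¹ g : ℂˣ) : ℂ) *
          (orbitProportion i.2.1 * isotypic i.1 F (i.2.1 * j.2.1)) := by
      intro g
      rw [mul_smul_comm, (isSemiInvariant_isotypic hH i.1 hF).smul]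
      ring
    simp only [h1]
    rw [← Finset.sum_mul, sum_character_mul, Matrix.blockDiagonal'_apply]
    obtain ⟨χ, s⟩ := i
    obtain ⟨ψ, t⟩ := j
    by_cases h : χ = ψ
    · subst h
      simp only [B, if_true, dif_pos, cast_eq, Matrix.mul_diagonal, Matrix.diagonal_mul,
        formMatrix, Matrix.of_apply]
      ring
    · simp only [h, if_false, dif_neg, not_false_iff]
      ring
  have hdet : E.det * E.det * Y.det = ∏ χ, (B χ).det := by
    rw [← det_blockDiagonal_sigma, ← hB, Matrix.det_mul, Matrix.det_mul, Matrix.det_transpose]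
    ring
  have hBdet : ∏ χ, (B χ).det = (∏ i : ι, (orbitProportion i.2.1 * n)) *
      ∏ χ : Mˣ →* ℂˣ, (∏ s : liveReps T χ, orbitProportion s.1) *
          (formMatrix T χ (isotypic χ F)).det := by
    rw [Fintype.prod_sigma, ← Finset.prod_mul_distrib]
    refine Finset.prod_congr rfl fun χ _ => ?_
    simp only [B, Matrix.det_mul, Matrix.det_diagonal]
    ring
  rw [hE2, hBdet] at hdet
  rw [hY]
  apply mul_left_cancel₀ hne
  linear_combination ((ε : ℤ) : ℂ) * hdet -
    (∏ i : ι, (orbitProportion i.2.1 * n)) * Y.det * hε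

end

/-! ### The local monoids of a finite commutative semigroup -/

section

variable {S : Type u} [CommSemigroup S]

theorem idem_le_iff (e f : Idem S) : e ≤ f ↔ (e : S) * f = e := Iff.rfl

theorem IsPlus.unique {s : S} {e f : Idem S} (he : IsPlus s e) (hf : IsPlus s f) : e = f :=
  IsLeast.unique he hf

theorem LocalMonoid.val_mul {e : Idem S} (s t : LocalMonoid e) : (s * t).val = s.val * t.val := rfl

theorem LocalMonoid.val_injective (e : Idem S) :
    Function.Injective (LocalMonoid.val : LocalMonoid e → S) :=
  Subtype.val_injective

theorem LocalMonoid.val_mul_idem {e : Idem S} (s : LocalMonoid e) : s.val * (e : S) = s.val :=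
  congrArg LocalMonoid.val (mul_one s)

theorem one_mem_HTilde (e : Idem S) : (1 : LocalMonoid e) ∈ HTilde e :=
  ⟨e.2, fun _ hf => hf⟩

theorem one_mem_liveSet {e : Idem S} {χ : Characters e} :
    (1 : LocalMonoid e) ∈ liveSet (HTilde e) χ :=
  ⟨one_mem_HTilde e, stabilizer_one_le⟩

theorem isTransversal_of_isRepSet {e : Idem S} {T : Set (LocalMonoid e)} (hT : IsRepSet e T) :
    IsTransversal (HTilde e) T :=
  ⟨hT.subset, hT.existsUnique, hT.one_mem⟩

variable [Finite S]

theorem isLocalPart_HTilde (e : Idem S) : IsLocalPart (HTilde e) where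
  of_mul {s t} h := ⟨s.val_mul_idem, fun f hf => h.2 (by
    change s.val * t.val * (f : S) = s.val * t.val
    rw [mul_right_comm, show s.val * (f : S) = s.val from hf])⟩
  isUnit_of_mul_eq {s t} hs h := by
    obtain ⟨n, hn, hid⟩ := exists_pow_isIdempotentElem t
    have hpow : ∀ k, s * t ^ k = s := by
      intro k
      induction k with
      | zero => rw [pow_zero, mul_one]
      | succ k ih => rw [pow_succ, ← mul_assoc, ih, h]
    let f : Idem S := ⟨(t ^ n).val, congrArg LocalMonoid.val hid⟩
    have hf : e ≤ f := hs.2 (congrArg LocalMonoid.val (hpow n))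
    have h1 : (1 : LocalMonoid e) * t ^ n = 1 := LocalMonoid.val_injective e ((idem_le_iff e f).mp hf)
    rw [one_mul] at h1
    exact (isUnit_pow_iff hn.ne').mp (h1 ▸ isUnit_one)

theorem coe_mem_idealBelow_iff {e : Idem S} (s : LocalMonoid e) :
    (s : WithZero (LocalMonoid e)) ∈ idealBelow e ↔ s ∉ HTilde e := by
  constructor
  · rintro (h | ⟨t, ht, f, hf, hlt⟩) hs
    · exact WithZero.coe_ne_zero h
    · rw [← WithZero.coe_inj.mp ht] at hf
      exact hlt.ne (hf.unique hs)
  · intro hs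
    obtain ⟨f, hf⟩ := exists_isPlus s.val e s.val_mul_idem
    refine Or.inr ⟨s, rfl, f, hf, lt_of_le_of_ne (hf.2 s.val_mul_idem) ?_⟩
    rintro rfl
    exact hs hf

/-! ### The monoid of orbits and its annihilating elements -/

theorem ReesQuotient.mk_eq_mk {M : Type u} [CommMonoidWithZero M] (I : SemigroupIdeal M) (a b : M) :
    ReesQuotient.mk I a = ReesQuotient.mk I b ↔ a = b ∨ (a ∈ I ∧ b ∈ I) :=
  Con.eq _

theorem ReesQuotient.mk_zero {M : Type u} [CommMonoidWithZero M] (I : SemigroupIdeal M) :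
    ReesQuotient.mk I 0 = 0 := rfl

theorem ReesQuotient.mk_surjective {M : Type u} [CommMonoidWithZero M] (I : SemigroupIdeal M) :
    Function.Surjective (ReesQuotient.mk I) :=
  Con.mk'_surjective

theorem OrbitMonoid.mk_eq_mk {G M : Type u} [Group G] [CommMonoidWithZero M] (φ : G →* M)
    (a b : M) : OrbitMonoid.mk φ a = OrbitMonoid.mk φ b ↔ ∃ g, b = φ g * a :=
  Con.eq _

theorem OrbitMonoid.mk_zero {G M : Type u} [Group G] [CommMonoidWithZero M] (φ : G →* M) :
    OrbitMonoid.mk φ 0 = 0 := rfl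

theorem OrbitMonoid.mk_surjective {G M : Type u} [Group G] [CommMonoidWithZero M] (φ : G →* M) :
    Function.Surjective (OrbitMonoid.mk φ) :=
  Con.mk'_surjective

variable {e : Idem S} {χ : Characters e}

theorem toHTildeZero_eq_iff (s t : LocalMonoid e) :
    toHTildeZero e s = toHTildeZero e t ↔ s = t ∨ (s ∉ HTilde e ∧ t ∉ HTilde e) := by
  rw [← coe_mem_idealBelow_iff, ← coe_mem_idealBelow_iff]
  exact (ReesQuotient.mk_eq_mk _ _ _).trans (or_congr_left WithZero.coe_inj)

theorem toHTildeZero_eq_zero_iff (s : LocalMonoid e) : toHTildeZero e s = 0 ↔ s ∉ HTilde e := by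
  rw [← coe_mem_idealBelow_iff, ← ReesQuotient.mk_zero]
  refine (ReesQuotient.mk_eq_mk _ _ _).trans ⟨?_, fun h => Or.inr ⟨h, Or.inl rfl⟩⟩
  rintro (h | h)
  · exact absurd h WithZero.coe_ne_zero
  · exact h.1

theorem unitsToHTildeZero_mul (g : MaxSubgroup e) (s : LocalMonoid e) :
    unitsToHTildeZero e g * toHTildeZero e s = toHTildeZero e (g • s) :=
  (map_mul (toHTildeZero e) (g : LocalMonoid e) s).symm

theorem toHTildeZero_mem_idealChi_iff {s : LocalMonoid e} (hs : s ∈ HTilde e) :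
    toHTildeZero e s ∈ idealChi e χ ↔ s ∉ liveSet (HTilde e) χ := by
  have h1 : s ∉ liveSet (HTilde e) χ ↔ ∃ g : MaxSubgroup e, g • s = s ∧ g ∉ χ.ker := by
    rw [liveSet, Set.mem_ofPred_eq, not_and]
    refine ⟨fun h => ?_, ?_⟩
    · obtain ⟨g, hg, hχ⟩ := SetLike.not_le_iff_exists.mp (h hs)
      exact ⟨g, hg, hχ⟩
    · rintro ⟨g, hg, hχ⟩ - hle
      exact hχ (hle hg)
  rw [h1]
  refine exists_congr fun g => and_congr_left fun _ => ?_
  rw [unitsToHTildeZero_mul, toHTildeZero_eq_iff]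
  exact or_iff_left fun h => h.2 hs

theorem mk_toHTildeZero_eq_zero_iff (s : LocalMonoid e) :
    ReesQuotient.mk (idealChi e χ) (toHTildeZero e s) = 0 ↔ s ∉ liveSet (HTilde e) χ := by
  rw [← ReesQuotient.mk_zero, ReesQuotient.mk_eq_mk, toHTildeZero_eq_zero_iff]
  by_cases hs : s ∈ HTilde e
  · rw [toHTildeZero_mem_idealChi_iff hs, or_iff_right (not_not.mpr hs)]
    refine ⟨And.left, fun h => ⟨h, ?_⟩⟩
    obtain ⟨g, -, hg⟩ := (toHTildeZero_mem_idealChi_iff hs).mpr h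
    exact ⟨g, mul_zero _, hg⟩
  · exact iff_of_true (Or.inl hs) fun h => hs h.1

theorem unitsToMChi_mul (g : MaxSubgroup e) (s : LocalMonoid e) :
    unitsToMChi e χ g * ReesQuotient.mk (idealChi e χ) (toHTildeZero e s) =
      ReesQuotient.mk (idealChi e χ) (toHTildeZero e (g • s)) := by
  rw [← unitsToHTildeZero_mul, map_mul]
  rfl

theorem orbitClass_eq_zero_iff (s : LocalMonoid e) :
    orbitClass e χ s = 0 ↔ s ∉ liveSet (HTilde e) χ := by
  rw [← mk_toHTildeZero_eq_zero_iff, ← OrbitMonoid.mk_zero, eq_comm]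
  refine (OrbitMonoid.mk_eq_mk _ _ _).trans ?_
  simp only [mul_zero, exists_const]
  rfl

theorem orbitClass_eq_iff {s : LocalMonoid e} (hs : s ∈ liveSet (HTilde e) χ) (t : LocalMonoid e) :
    orbitClass e χ s = orbitClass e χ t ↔ ∃ g : MaxSubgroup e, t = g • s := by
  refine (OrbitMonoid.mk_eq_mk _ _ _).trans (exists_congr fun g => ?_)
  have hg := (smul_mem_liveSet_iff (isLocalPart_HTilde e) g s).mpr hs
  refine (Eq.congr_right (unitsToMChi_mul g s)).trans ?_
  refine (ReesQuotient.mk_eq_mk _ _ _).trans ⟨?_, fun h => Or.inl (by rw [h])⟩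
  rintro (h | h)
  · exact ((toHTildeZero_eq_iff _ _).mp h).resolve_right fun h' => h'.2 hg.1
  · exact absurd hg ((toHTildeZero_mem_idealChi_iff hg.1).mp h.2)

theorem eq_zero_or_eq_orbitClass (m : MChiModG e χ) : m = 0 ∨ ∃ s, m = orbitClass e χ s := by
  obtain ⟨m, rfl⟩ := OrbitMonoid.mk_surjective _ m
  obtain ⟨m, rfl⟩ := ReesQuotient.mk_surjective _ m
  obtain ⟨m, rfl⟩ := ReesQuotient.mk_surjective _ m
  induction m using WithZero.recZeroCoe with
  | zero => exact Or.inl rfl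
  | coe s => exact Or.inr ⟨s, rfl⟩

theorem orbitClass_eq_one_iff (s : LocalMonoid e) : orbitClass e χ s = 1 ↔ IsUnit s := by
  rw [← map_one (orbitClass e χ), eq_comm, orbitClass_eq_iff one_mem_liveSet]
  refine exists_congr fun g => ?_
  rw [Units.smul_def, smul_eq_mul, mul_one, eq_comm]

theorem isAnnihilating_orbitClass_iff (s : LocalMonoid e) :
    IsAnnihilating (orbitClass e χ s) ↔ IsSocleElement (HTilde e) χ s := by
  refine and_congr ((orbitClass_eq_zero_iff s).not.trans not_not) ⟨fun h t ht => ?_, fun h n hn => ?_⟩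
  · rw [← orbitClass_eq_zero_iff, map_mul]
    exact h _ ((orbitClass_eq_one_iff t).not.mpr ht)
  · rcases eq_zero_or_eq_orbitClass n with rfl | ⟨t, rfl⟩
    · exact mul_zero _
    · rw [← map_mul, orbitClass_eq_zero_iff]
      exact h t ((orbitClass_eq_one_iff t).not.mp hn)

/-- There is always an annihilating element; it is unique as soon as one of the forms of weight
`χ` is nondegenerate. -/
theorem existsUnique_isAnnihilating {T : Set (LocalMonoid e)} [DecidableEq (liveReps T χ)]
    (hT : IsTransversal (HTilde e) T) {Φ : LocalMonoid e → ℂ}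
    (hΦ : IsSemiInvariant (HTilde e) χ Φ) (h : (formMatrix T χ Φ).det ≠ 0) :
    ∃! m : MChiModG e χ, IsAnnihilating m := by
  have hH := isLocalPart_HTilde e
  obtain ⟨a, ha⟩ := exists_isSocleElement hH ⟨1, one_mem_liveSet (χ := χ)⟩
  refine ⟨orbitClass e χ a, (isAnnihilating_orbitClass_iff a).mpr ha, fun m hm => ?_⟩
  obtain rfl | ⟨b, rfl⟩ := eq_zero_or_eq_orbitClass m
  · exact absurd rfl hm.1
  · refine ((orbitClass_eq_iff ha.1 b).mpr ?_).symm
    refine exists_smul_eq_of_isSocleElement hH hT hΦ ?_ ha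
      ((isAnnihilating_orbitClass_iff b).mp hm)
    convert h

end

/-! ### Möbius inversion and reduction to the local monoids -/

section

variable {S : Type u} [CommSemigroup S]

theorem natLE_eq_mul {w s : S} {e : Idem S} (h : NatLE w s) (he : IsPlus w e) :
    w = s * (e : S) := by
  obtain ⟨f, rfl⟩ := h
  have hf : e ≤ f := he.2 (by
    change s * (f : S) * f = s * f
    rw [mul_assoc, f.2.eq])
  have h1 : s * (f : S) * e = s * f := he.1
  rw [← h1, mul_assoc, mul_comm (f : S), (idem_le_iff e f).mp hf]

theorem isPlus_mul_of_natLE {w s t : S} {e : Idem S} (h : NatLE w (s * t)) (he : IsPlus w e) :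
    IsPlus (s * (e : S)) e := by
  refine ⟨?_, fun f hf => he.2 ?_⟩
  · change s * (e : S) * e = s * e
    rw [mul_assoc, e.2.eq]
  · have hf' : s * (e : S) * f = s * e := hf
    change w * (f : S) = w
    rw [natLE_eq_mul h he, mul_right_comm s t, mul_right_comm, hf']

/-- The elements `u`, `v` and `uv` lie in the same class `H̃_e`. -/
def SamePlus (u v : S) : Prop :=
  ∃ e : Idem S, IsPlus u e ∧ IsPlus v e ∧ IsPlus (u * v) e

open Classical in
/-- The structure matrix of the direct product of the contracted algebras of the monoids `H̃_e⁰`,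
evaluated at `y`. -/
def splitMatrix (y : S → ℂ) : Matrix S S ℂ :=
  Matrix.of fun u v => if SamePlus u v then y (u * v) else 0

open Classical in
/-- The restriction of `y` to `H̃_e`, extended by zero to `eSe`. -/
def localValue (y : S → ℂ) (e : Idem S) (m : LocalMonoid e) : ℂ :=
  if m ∈ HTilde e then y m.val else 0

theorem localValue_eq_zero (y : S → ℂ) {e : Idem S} {m : LocalMonoid e} (hm : m ∉ HTilde e) :
    localValue y e m = 0 :=
  if_neg hm

variable [Fintype S]

theorem exists_isPlus_of_squareEqSelf (h : SquareEqSelf S) (s : S) : ∃ e : Idem S, IsPlus s e := by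
  obtain ⟨e, he⟩ := exists_idem_mul h s
  exact exists_isPlus s e he

open Classical in
theorem sum_mobius (h : SquareEqSelf S) (s t : S) :
    ∑ u : S, (if NatLE s u ∧ NatLE u t then mobius h s u else 0) = if s = t then 1 else 0 := by
  let _ : PartialOrder S := naturalOrder h
  let _ : DecidableLE S := Classical.decRel _
  let _ : DecidableLT S := Classical.decRel _
  let _ : DecidableEq S := Classical.decEq _
  let _ : LocallyFiniteOrder S := Fintype.toLocallyFiniteOrder
  have h1 := IncidenceAlgebra.sum_Icc_mu_right (𝕜 := ℤ) s t
  rw [← Finset.sum_filter]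
  convert h1 using 2
  on_goal 2 => rfl
  ext u
  rw [Finset.mem_Icc, Finset.mem_filter]
  exact and_iff_right (Finset.mem_univ u)

open Classical in
/-- The zeta matrix of the natural partial order. -/
def zetaMatrix (S : Type u) [CommSemigroup S] : Matrix S S ℤ :=
  Matrix.of fun u s => if NatLE u s then 1 else 0

open Classical in
/-- The Möbius matrix of the natural partial order. -/
def mobiusMatrix (h : SquareEqSelf S) : Matrix S S ℤ :=
  Matrix.of fun t u => if NatLE t u then mobius h t u else 0

open Classical in
theorem mobiusMatrix_mul_zetaMatrix (h : SquareEqSelf S) :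
    mobiusMatrix h * zetaMatrix S = 1 := by
  ext s t
  rw [Matrix.mul_apply, Matrix.one_apply, ← sum_mobius h s t]
  refine Finset.sum_congr rfl fun u _ => ?_
  simp only [mobiusMatrix, zetaMatrix, Matrix.of_apply, mul_ite, mul_one, mul_zero]
  by_cases h1 : NatLE s u <;> by_cases h2 : NatLE u t <;> simp [h1, h2]

theorem det_zetaMatrix_mul_self [DecidableEq S] (h : SquareEqSelf S) :
    (zetaMatrix S).det * (zetaMatrix S).det = 1 := by
  have h1 : (mobiusMatrix h).det * (zetaMatrix S).det = 1 := by
    rw [← Matrix.det_mul]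
    convert Matrix.det_one (n := S) (R := ℤ)
    convert mobiusMatrix_mul_zetaMatrix h
  exact Int.isUnit_mul_self (IsUnit.of_mul_eq_one_right _ h1)

/-- The value of `y_s = ∑_{t ≤ s} μ(t, s) x_t` at a point `x`. -/
def mobiusValue (h : SquareEqSelf S) (x : S → ℂ) (s : S) : ℂ :=
  MvPolynomial.eval x (mobiusForm h s)

theorem mobiusValue_eq (h : SquareEqSelf S) (x : S → ℂ) (s : S) :
    mobiusValue h x s = ∑ t : S, (mobiusMatrix h t s : ℂ) * x t := by
  classical
  rw [mobiusValue, mobiusForm, map_sum, Finset.sum_filter]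
  refine Finset.sum_congr rfl fun t _ => ?_
  rw [mobiusMatrix, Matrix.of_apply]
  split_ifs
  · simp
  · simp

open Classical in
theorem sum_mobiusValue (h : SquareEqSelf S) (x : S → ℂ) (s : S) :
    ∑ u : S with NatLE u s, mobiusValue h x u = x s := by
  have h1 : ∀ t, ∑ u, (mobiusMatrix h t u : ℂ) * (zetaMatrix S u s : ℂ) = if t = s then 1 else 0 := by
    intro t
    have := congrArg (fun A : Matrix S S ℤ => ((A t s : ℤ) : ℂ)) (mobiusMatrix_mul_zetaMatrix h)
    simpa [Matrix.mul_apply, Matrix.one_apply] using this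
  calc ∑ u : S with NatLE u s, mobiusValue h x u
      = ∑ u : S, ∑ t : S, (mobiusMatrix h t u : ℂ) * (zetaMatrix S u s : ℂ) * x t := by
        rw [Finset.sum_filter]
        refine Finset.sum_congr rfl fun u _ => ?_
        rw [mobiusValue_eq]
        simp only [zetaMatrix, Matrix.of_apply]
        split_ifs <;> simp
    _ = x s := by
        rw [Finset.sum_comm]
        simp only [← Finset.sum_mul, h1]
        simp

open Classical in
/-- The elements `w ≤ st` are the products `uv` with `u ≤ s`, `v ≤ t` and `u⁺ = v⁺ = (uv)⁺`, each
in a unique way: `u = s w⁺` and `v = t w⁺`. -/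
theorem sum_natLE_mul (h : SquareEqSelf S) (y : S → ℂ) (s t : S) :
    ∑ w : S with NatLE w (s * t), y w =
      ∑ p : S × S with NatLE p.1 s ∧ NatLE p.2 t, splitMatrix y p.1 p.2 := by
  choose plus hplus using exists_isPlus_of_squareEqSelf h
  simp only [splitMatrix, Matrix.of_apply]
  rw [← Finset.sum_filter, Finset.filter_filter]
  have key : ∀ w, NatLE w (s * t) → s * (plus w : S) * (t * (plus w : S)) = w := by
    intro w hw
    rw [mul_mul_mul_comm, (plus w).2.eq]
    exact (natLE_eq_mul hw (hplus w)).symm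
  refine Finset.sum_nbij' (fun w => (s * (plus w : S), t * (plus w : S))) (fun p => p.1 * p.2)
    ?_ ?_ ?_ ?_ ?_
  · intro w hw
    have hw : NatLE w (s * t) := (Finset.mem_filter.mp hw).2
    refine Finset.mem_filter.mpr ⟨Finset.mem_univ _, ⟨⟨_, rfl⟩, ⟨_, rfl⟩⟩, plus w,
      isPlus_mul_of_natLE hw (hplus w), isPlus_mul_of_natLE (mul_comm s t ▸ hw) (hplus w), ?_⟩
    rw [key w hw]
    exact hplus w
  · rintro ⟨u, v⟩ hp
    obtain ⟨-, ⟨⟨f, rfl⟩, ⟨g, rfl⟩⟩, -⟩ := Finset.mem_filter.mp hp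
    exact Finset.mem_filter.mpr ⟨Finset.mem_univ _, ⟨(f : S) * g, f.2.mul g.2⟩,
      mul_mul_mul_comm _ _ _ _⟩
  · intro w hw
    exact key w (Finset.mem_filter.mp hw).2
  · rintro ⟨u, v⟩ hp
    obtain ⟨-, ⟨hu, hv⟩, e, hue, hve, huve⟩ := Finset.mem_filter.mp hp
    have he : plus (u * v) = e := (hplus _).unique huve
    simp only [he]
    rw [← natLE_eq_mul hu hue, ← natLE_eq_mul hv hve]
  · intro w hw
    rw [key w (Finset.mem_filter.mp hw).2]

theorem det_eq_det_splitMatrix [DecidableEq S] (h : SquareEqSelf S) (x : S → ℂ) :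
    (Matrix.of fun s t => x (s * t)).det = (splitMatrix (mobiusValue h x)).det := by
  classical
  let Z : Matrix S S ℂ := (zetaMatrix S).map (Int.castRingHom ℂ)
  have hZ : Z.det * Z.det = 1 := by
    change ((Int.castRingHom ℂ).mapMatrix (zetaMatrix S)).det *
      ((Int.castRingHom ℂ).mapMatrix (zetaMatrix S)).det = 1
    rw [← RingHom.map_det, ← map_mul, det_zetaMatrix_mul_self h, map_one]
  have hprod : (Matrix.of fun s t => x (s * t)) =
      Z.transpose * splitMatrix (mobiusValue h x) * Z := by
    ext s t
    rw [Matrix.of_apply, ← sum_mobiusValue h x (s * t), sum_natLE_mul h, Finset.sum_filter,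
      Fintype.sum_prod_type, Matrix.mul_apply, Finset.sum_comm]
    refine Finset.sum_congr rfl fun v _ => ?_
    rw [Matrix.mul_apply, Finset.sum_mul]
    refine Finset.sum_congr rfl fun u _ => ?_
    simp only [Z, Matrix.transpose_apply, Matrix.map_apply, zetaMatrix, Matrix.of_apply]
    by_cases h1 : NatLE u s <;> by_cases h2 : NatLE v t <;> simp [h1, h2]
  rw [hprod, Matrix.det_mul, Matrix.det_mul, Matrix.det_transpose]
  linear_combination (splitMatrix (mobiusValue h x)).det * hZ

open Classical in
theorem det_splitMatrix [∀ e : Idem S, Fintype (HTilde e)] (h : SquareEqSelf S) (y : S → ℂ) :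
    (splitMatrix y).det =
      ∏ e : Idem S, (Matrix.of fun u v : HTilde e => localValue y e (u.1 * v.1)).det := by
  let f : (Σ e : Idem S, HTilde e) → S := fun p => p.2.1.val
  have hf : Function.Bijective f := by
    constructor
    · rintro ⟨e, u, hu⟩ ⟨e', v, hv⟩ huv
      change u.val = v.val at huv
      have hu' : IsPlus u.val e := hu
      have hv' : IsPlus v.val e' := hv
      rw [← huv] at hv'
      obtain rfl := hu'.unique hv'
      obtain rfl := LocalMonoid.val_injective e huv
      rfl
    · intro s
      obtain ⟨e, he⟩ := exists_isPlus_of_squareEqSelf h s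
      exact ⟨⟨e, ⟨⟨s, mem_corner_of_isPlus he⟩, he⟩⟩, rfl⟩
  rw [← Matrix.det_submatrix_equiv_self (Equiv.ofBijective f hf), ← det_blockDiagonal_sigma]
  congr 1
  ext ⟨e, u, hu⟩ ⟨e', v, hv⟩
  rw [Matrix.submatrix_apply, Matrix.blockDiagonal'_apply]
  change (if SamePlus u.val v.val then y (u.val * v.val) else 0) = _
  have hu' : IsPlus u.val e := hu
  have hv' : IsPlus v.val e' := hv
  by_cases hee : e = e'
  · subst hee
    simp only [dif_pos, cast_eq, Matrix.of_apply]
    rw [localValue]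
    refine if_congr ⟨?_, fun h => ⟨e, hu', hv', h⟩⟩ rfl rfl
    rintro ⟨e0, h1, -, h2⟩
    obtain rfl := h1.unique hu'
    exact h2
  · rw [dif_neg hee, if_neg]
    rintro ⟨e0, h1, h2, -⟩
    exact hee ((hu'.unique h1).trans (h2.unique hv'))

theorem inv_character_eq_conj {G : Type u} [Group G] [Finite G] (χ : G →* ℂˣ) (g : G) :
    ((χ⁻¹ g : ℂˣ) : ℂ) = (starRingEnd ℂ) (χ g : ℂ) := by
  rw [MonoidHom.inv_apply, Units.val_inv_eq_inv_val]
  refine Complex.inv_eq_conj (Complex.norm_eq_one_of_pow_eq_one (n := Nat.card G) ?_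
    Nat.card_pos.ne')
  rw [← Units.val_pow_eq_pow_val, ← map_pow, pow_card_eq_one', map_one, Units.val_one]

theorem eval_linearForm (h : SquareEqSelf S) (x : S → ℂ) {e : Idem S} (χ : Characters e)
    {s : LocalMonoid e} (hs : s ∈ HTilde e) :
    MvPolynomial.eval x (linearForm h χ s) =
      isotypic χ (localValue (mobiusValue h x) e) s := by
  rw [linearForm, isotypic, map_sum]
  refine Finset.sum_congr rfl fun g _ => ?_
  rw [map_mul, MvPolynomial.eval_C, inv_character_eq_conj, localValue,
    if_pos (((isLocalPart_HTilde e).smul_mem_iff g s).mpr hs)]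
  rfl

end

/-! ### Evaluation of the semigroup determinant -/

theorem eval_theta {S : Type u} [Mul S] [Fintype S] [DecidableEq S] (x : S → ℂ) :
    MvPolynomial.eval x (theta S) = (Matrix.of fun s t => x (s * t)).det := by
  rw [theta, RingHom.map_det]
  congr 1
  ext s t
  simp [cayleyTable]

/-- If `s ∉ S²` and some form `x(st)` is nondegenerate, then the functional dual to `s` is
`t ↦ ∑ c_r x(rt)`. It vanishes on `S²`, so `∑ c_r rs` lies in the radical of the form, hence is
zero, and then the functional vanishes at `s`, where it should be `1`. -/
theorem theta_eq_zero {S : Type u} [CommSemigroup S] [Fintype S] [DecidableEq S]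
    (h : ¬ SquareEqSelf S) : theta S = 0 := by
  obtain ⟨s, hs⟩ : ∃ s : S, ∀ a b : S, a * b ≠ s := by
    by_contra! hcon
    refine h (Set.eq_univ_of_forall fun s => ?_)
    obtain ⟨a, b, hab⟩ := hcon s
    exact ⟨a, trivial, b, trivial, hab⟩
  refine MvPolynomial.funext fun x => ?_
  rw [eval_theta, map_zero]
  by_contra hdet
  let P : Matrix S S ℂ := Matrix.of fun s t => x (s * t)
  have hP : IsUnit P.det := isUnit_iff_ne_zero.mpr hdet
  let c : S → ℂ := Matrix.vecMul (Pi.single s 1) P⁻¹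
  have hc : ∀ t, ∑ r, c r * x (r * t) = (Pi.single s 1 : S → ℂ) t := by
    intro t
    have h1 : Matrix.vecMul c P = Pi.single s 1 := by
      rw [Matrix.vecMul_vecMul, Matrix.nonsing_inv_mul _ hP, Matrix.vecMul_one]
    exact congrFun h1 t
  let d : S → ℂ := fun w => ∑ r with r * s = w, c r
  have hd : ∀ f : S → ℂ, ∑ w, d w * f w = ∑ r, c r * f (r * s) := by
    intro f
    rw [← Finset.sum_fiberwise Finset.univ (fun r => r * s) fun r => c r * f (r * s)]
    refine Finset.sum_congr rfl fun w _ => ?_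
    rw [Finset.sum_mul]
    refine Finset.sum_congr rfl fun r hr => ?_
    rw [(Finset.mem_filter.mp hr).2]
  have hd0 : d = 0 := by
    refine Matrix.eq_zero_of_vecMul_eq_zero hdet (funext fun u => ?_)
    change ∑ w, d w * x (w * u) = 0
    rw [hd]
    simp only [mul_assoc]
    rw [hc, Pi.single_eq_of_ne (hs s u)]
  have h1 := hd x
  rw [hc, Pi.single_eq_same, hd0] at h1
  simp at h1

open Classical in
/-- The factorization of the determinant over all idempotents and characters, before the
determinants of the forms of each weight are evaluated. -/
theorem exists_sign_eval_theta {S : Type u} [CommSemigroup S] [Fintype S] [DecidableEq S]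
    (h : SquareEqSelf S) (T : (e : Idem S) → Set (LocalMonoid e))
    (hT : ∀ e, IsTransversal (HTilde e) (T e)) :
    ∃ ε : ℤˣ, ∀ x : S → ℂ, MvPolynomial.eval x (theta S) =
      ((ε : ℤ) : ℂ) * ∏ e : Idem S, ∏ χ : Characters e,
        (∏ s : liveReps (T e) χ, orbitProportion s.1) *
          (formMatrix (T e) χ (isotypic χ (localValue (mobiusValue h x) e))).det := by
  have (e : Idem S) : Fintype (HTilde e) := Fintype.ofFinite _
  choose ε hε using fun e => exists_sign_det_form (isLocalPart_HTilde e) (hT e)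
  refine ⟨∏ e, ε e, fun x => ?_⟩
  rw [eval_theta, det_eq_det_splitMatrix h]
  have h1 := det_splitMatrix h (mobiusValue h x)
  simp only [fun e => hε e _ fun m hm => localValue_eq_zero (mobiusValue h x) hm] at h1
  rw [Finset.prod_mul_distrib] at h1
  rw [Units.coe_prod, Int.cast_prod]
  convert h1

end SemigroupDet

end

theorem theoremt (S : Type*) [CommSemigroup S] [Fintype S] [DecidableEq S] :
    (¬ SemigroupDet.SquareEqSelf S → SemigroupDet.theta S = 0) ∧
    ∀ h : SemigroupDet.SquareEqSelf S,
      (SemigroupDet.theta S ≠ 0 →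
        ∀ (e : SemigroupDet.Idem S) (χ : SemigroupDet.Characters e),
          ∃! m : SemigroupDet.MChiModG e χ, SemigroupDet.IsAnnihilating m) ∧
      ((∀ (e : SemigroupDet.Idem S) (χ : SemigroupDet.Characters e),
          ∃! m : SemigroupDet.MChiModG e χ, SemigroupDet.IsAnnihilating m) →
        ∀ T : (e : SemigroupDet.Idem S) → Set (SemigroupDet.LocalMonoid e),
          (∀ e, SemigroupDet.IsRepSet e (T e)) →
          ∃ sχ : (e : SemigroupDet.Idem S) → SemigroupDet.Characters e →
              SemigroupDet.LocalMonoid e,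
            (∀ e χ, sχ e χ ∈ SemigroupDet.repChi (T e) χ ∧
              SemigroupDet.IsAnnihilating (SemigroupDet.orbitClass e χ (sχ e χ))) ∧
            ∃ ε : ℤˣ,
              SemigroupDet.theta S =
                MvPolynomial.C ((ε : ℤ) : ℂ) *
                  ∏ e : SemigroupDet.Idem S, ∏ χ : SemigroupDet.Characters e,
                    MvPolynomial.C (SemigroupDet.orbitRatio (T e) χ *
                        SemigroupDet.detA (T e) χ (sχ e χ)) *
                      SemigroupDet.linearForm h χ (sχ e χ) ^
                        Nat.card (SemigroupDet.repChi (T e) χ)) := by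
  classical
  open SemigroupDet in
  refine ⟨theta_eq_zero, fun h => ⟨fun hθ e χ => ?_, fun huniq T hT => ?_⟩⟩
  · choose T hT using fun e : Idem S => exists_isTransversal (isLocalPart_HTilde e) (one_mem_HTilde e)
    obtain ⟨ε, hε⟩ := exists_sign_eval_theta h T hT
    obtain ⟨x, hx⟩ : ∃ x, MvPolynomial.eval x (theta S) ≠ 0 := by
      by_contra! hcon
      exact hθ (MvPolynomial.funext fun x => by rw [hcon x, map_zero])
    rw [hε x] at hx
    have h1 := Finset.prod_ne_zero_iff.mp (right_ne_zero_of_mul hx) e (Finset.mem_univ e)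
    have h2 := Finset.prod_ne_zero_iff.mp h1 χ (Finset.mem_univ χ)
    exact existsUnique_isAnnihilating (hT e)
      (isSemiInvariant_isotypic (isLocalPart_HTilde e) χ fun m hm => localValue_eq_zero _ hm)
      (right_ne_zero_of_mul h2)
  · have hT' := fun e => isTransversal_of_isRepSet (hT e)
    have hex : ∀ (e : Idem S) (χ : Characters e),
        ∃ s, s ∈ liveReps (T e) χ ∧ IsAnnihilating (orbitClass e χ s) := by
      intro e χ
      obtain ⟨m, hm, -⟩ := huniq e χ
      obtain rfl | ⟨s, rfl⟩ := eq_zero_or_eq_orbitClass m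
      · exact absurd rfl hm.1
      · have hs := (isAnnihilating_orbitClass_iff s).mp hm
        obtain ⟨t, ht, g, hg⟩ := (hT' e).exists_smul_eq (isLocalPart_HTilde e) hs.1
        refine ⟨t, ht, ?_⟩
        rwa [(orbitClass_eq_iff ((hT' e).liveReps_subset ht) s).mpr ⟨g, hg⟩]
    choose sχ hlive hann using hex
    obtain ⟨ε, hε⟩ := exists_sign_eval_theta h T hT'
    refine ⟨sχ, fun e χ => ⟨hlive e χ, hann e χ⟩, ε, MvPolynomial.funext fun x => ?_⟩
    rw [hε x, map_mul, MvPolynomial.eval_C, map_prod]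
    congr 1
    refine Finset.prod_congr rfl fun e _ => ?_
    rw [map_prod]
    refine Finset.prod_congr rfl fun χ _ => ?_
    have hH := isLocalPart_HTilde e
    rw [det_formMatrix hH (hT' e) (isSemiInvariant_isotypic hH χ fun m hm =>
      localValue_eq_zero _ hm) ((isAnnihilating_orbitClass_iff _).mp (hann e χ)), map_mul, map_pow,
      MvPolynomial.eval_C, eval_linearForm h x χ ((hT' e).subset (hlive e χ).1), ← mul_assoc]
    congr 2
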